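/- Let $\mathbb{N}=\{1,2,3,\dots\}$. For $k\ge 0$ let $d_k(n)$ be the number of ordered ways of writing the positive integer $n$ as a product of $k$ positive factors, and for $h,k,l\in\mathbb{N}$ put $D_{h,k,l}(x)=\sum_{n\le x}d_k(n+h)\,d_l(n)$. Let $$C_{k,l}=\prod_p\Bigl(\bigl(1-p^{-1}\bigr)^{l-1}+\bigl(1-p^{-1}\bigr)^{k-1}-\bigl(1-p^{-1}\bigr)^{k+l-2}\Bigr)$$ and, with $h=\prod p^{\gamma}$, $$f_{k,l}(h)=\prod_{p\mid h}\frac{(1-p^{-1})\sum_{\alpha=0}^{\gamma}d_{l-1}(p^{\alpha})\sum_{\beta=\alpha}^{\infty}d_k(p^{\beta})p^{-\beta}+d_k(p^{\gamma})\sum_{\alpha=\gamma+1}^{\infty}d_{l-1}(p^{\alpha})p^{-\alpha}}{(1-p^{-1})^{1-k}+(1-p^{-1})^{1-l}-1}.$$ For $g,k\in\mathbb{N}$, a real number $\theta$ with $0<\theta\le1$ is called an exponent of distribution $\theta_{g,k}$ for $d_k$ if for every $\varepsilon>0$ there are $\delta>0$ and $K$ such that for all real $x\ge1$, all integers $q\ge1$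 with $q\le x^{\theta-\varepsilon}$, and all residue classes $a\not\equiv0\pmod q$ with $\gcd(a,q)=g$, $$\Bigl|\sum_{\substack{n\le x\\ n\equiv a\,(\mathrm{mod}\,q)}}d_k(n)-\frac1{\phi(q/g)}\sum_{\substack{m\le x/g\\ \gcd(m,q/g)=1}}d_k(gm)\Bigr|\le \frac{K\,x^{1-\delta}}{\phi(q/g)}.$$ Let $h,k,l\in\mathbb{N}$ be fixed, and let $\theta_k$ be an exponent of distribution for $d_k$ for all $g\in\mathbb{N}$, that is, an exponent of distribution $\theta_{g,k}$ for each $g$ ($\delta$ and $K$ may depend on $g$). Then $$\liminf_{x\to\infty}\frac{D_{h,k,l}(x)}{x\log^{k+l-2}x}\ \ge\ \theta_k^{\,l-1}\,\frac{C_{k,l}\,f_{k,l}(h)}{(k-1)!\,(l-1)!}.$$ For instance, given the exponent $\theta_3=21/41$, for every $h\in\mathbb{N}$ $$\liminf_{x\to\infty}\frac{D_{h,3,3}(x)}{x\log^{4}x}\ \ge\ 0.262\,\frac{C_{3,3}\,f_{3,3}(h)}{4}.$$ -/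

import Mathlib

open Filter

/-- The `k`-fold divisor function: the number of ordered ways of writing `n` as a product of `k`
positive factors (with value `0` at `n = 0`). -/
def divisorFn (k n : ℕ) : ℕ := (Nat.finMulAntidiag k n).card

/-- The additive divisor sum `D_{h,k,l}(x) = ∑_{n ≤ x} d_k(n + h) d_l(n)`. -/
noncomputable def additiveDivisorSum (h k l : ℕ) (x : ℝ) : ℝ :=
  ∑ n ∈ Finset.Icc 1 ⌊x⌋₊, (divisorFn k (n + h) : ℝ) * (divisorFn l n : ℝ)

/-- The sum of `d_k(n)` over the `n ≤ x` in the residue class of `a` modulo `q`. -/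
noncomputable def divisorSumAP (k q a : ℕ) (x : ℝ) : ℝ :=
  ∑ n ∈ (Finset.Icc 1 ⌊x⌋₊).filter (fun n => n ≡ a [MOD q]), (divisorFn k n : ℝ)

/-- The expected value of `divisorSumAP k q a x` when `(a, q) = g`: the average
`φ(q/g)⁻¹ ∑_{m ≤ x/g} χ₀(m) d_k(g m)`, with `χ₀` the principal character modulo `q/g`. -/
noncomputable def divisorSumAPMain (k q g : ℕ) (x : ℝ) : ℝ :=
  (∑ m ∈ (Finset.Icc 1 ⌊x / (g : ℝ)⌋₊).filter (fun m => Nat.Coprime m (q / g)),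
    (divisorFn k (g * m) : ℝ)) / (Nat.totient (q / g) : ℝ)

/-- `θ ∈ (0, 1]` is an exponent of distribution `θ_{g,k}` for `d_k`: for every `ε > 0` there is
a power saving `δ > 0`, uniform over all moduli `q ≤ x^(θ - ε)` and all nonzero residue classes
`a` modulo `q` with `(a, q) = g`. -/
def IsExponentOfDistribution (g k : ℕ) (θ : ℝ) : Prop :=
  0 < θ ∧ θ ≤ 1 ∧
    ∀ ε : ℝ, 0 < ε → ∃ δ : ℝ, 0 < δ ∧ ∃ K : ℝ, ∀ (x : ℝ) (q a : ℕ),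
      1 ≤ x → 1 ≤ q → (q : ℝ) ≤ x ^ (θ - ε) → Nat.gcd a q = g → ¬ q ∣ a →
        |divisorSumAP k q a x - divisorSumAPMain k q g x|
          ≤ K * (x ^ (1 - δ) / (Nat.totient (q / g) : ℝ))

/-- `θ` is an exponent of distribution `θ_k` for `d_k` for all `g`
(the implied constants may depend on `g`). -/
def IsExponentForAllGcd (k : ℕ) (θ : ℝ) : Prop :=
  ∀ g : ℕ, 1 ≤ g → IsExponentOfDistribution g k θ

/-- The factor at the prime `p` of the Euler product `C_{k,l}`. -/
noncomputable def singularFactor (k l p : ℕ) : ℝ :=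
  (1 - (p : ℝ)⁻¹) ^ (l - 1) + (1 - (p : ℝ)⁻¹) ^ (k - 1) - (1 - (p : ℝ)⁻¹) ^ (k + l - 2)

/-- The constant `C_{k,l}`, an absolutely convergent product over all primes. -/
noncomputable def singularConst (k l : ℕ) : ℝ :=
  ∏' p : Nat.Primes, singularFactor k l (p : ℕ)

/-- The tail `∑_{β ≥ α} d_k(p^β) p^{-β}`. -/
noncomputable def divisorTail (k p α : ℕ) : ℝ :=
  ∑' j : ℕ, (divisorFn k (p ^ (α + j)) : ℝ) * ((p : ℝ)⁻¹) ^ (α + j)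

/-- The factor at the prime `p` of `f_{k,l}(h)`, where `p^γ` exactly divides `h`. -/
noncomputable def shiftLocalFactor (k l p γ : ℕ) : ℝ :=
  ((1 - (p : ℝ)⁻¹) *
      (∑ α ∈ Finset.Icc 0 γ, (divisorFn (l - 1) (p ^ α) : ℝ) * divisorTail k p α)
    + (divisorFn k (p ^ γ) : ℝ) * divisorTail (l - 1) p (γ + 1))
  / ((1 - (p : ℝ)⁻¹) ^ (1 - (k : ℤ)) + (1 - (p : ℝ)⁻¹) ^ (1 - (l : ℤ)) - 1)

/-- The arithmetic factor `f_{k,l}(h)`, a product over the primes dividing `h`. -/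
noncomputable def shiftFactor (k l h : ℕ) : ℝ :=
  ∏ p ∈ h.primeFactors, shiftLocalFactor k l p (h.factorization p)

/-- The product defining `C_{k,l}` converges. -/
theorem multipliable_singularFactor (k l : ℕ) (hk : 1 ≤ k) (hl : 1 ≤ l) :
    Multipliable (fun p : Nat.Primes => singularFactor k l (p : ℕ)) := by
  have key : ∀ (p : Nat.Primes) (m : ℕ), 0 ≤ 1 - (1 - ((p : ℕ) : ℝ)⁻¹) ^ m ∧
      1 - (1 - ((p : ℕ) : ℝ)⁻¹) ^ m ≤ m * ((p : ℕ) : ℝ)⁻¹ := by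
    intro p m
    have h2 : (1 : ℝ) ≤ ((p : ℕ) : ℝ) := by exact_mod_cast p.2.one_lt.le
    have h3 : ((p : ℕ) : ℝ)⁻¹ ≤ 1 := inv_le_one_of_one_le₀ h2
    have h4 : 0 ≤ ((p : ℕ) : ℝ)⁻¹ := by positivity
    constructor
    · have := pow_le_one₀ (n := m) (sub_nonneg.2 h3) (by linarith)
      linarith
    · have := one_add_mul_le_pow (a := -((p : ℕ) : ℝ)⁻¹) (by linarith) m
      rw [← sub_eq_add_neg] at this
      linarith
  have hs : Summable (fun p : Nat.Primes =>
      -((1 - (1 - ((p : ℕ) : ℝ)⁻¹) ^ (l - 1)) * (1 - (1 - ((p : ℕ) : ℝ)⁻¹) ^ (k - 1)))) := by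
    apply Summable.neg
    refine Summable.of_nonneg_of_le (fun p => mul_nonneg (key p _).1 (key p _).1)
      (fun p => mul_le_mul (key p _).2 (key p _).2 (key p _).1 (by positivity)) ?_
    have := (Nat.Primes.summable_rpow (r := -2)).2 (by norm_num)
    refine (this.mul_left (((l - 1 : ℕ) : ℝ) * ((k - 1 : ℕ) : ℝ))).congr fun p => ?_
    rw [Real.rpow_neg (Nat.cast_nonneg _), Real.rpow_two, ← inv_pow]
    ring
  refine (multipliable_one_add_of_summable hs.norm).congr fun p => ?_
  have e : k + l - 2 = (l - 1) + (k - 1) := by omega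
  simp only [singularFactor, e, pow_add]
  ring

/-- The series defining `divisorTail` converges. -/
theorem summable_divisorTail (k p α : ℕ) (hp : p.Prime) :
    Summable (fun j : ℕ => (divisorFn k (p ^ (α + j)) : ℝ) * ((p : ℝ)⁻¹) ^ (α + j)) := by
  have hb : ∀ n : ℕ, n ≠ 0 → divisorFn k n ≤ n.divisors.card ^ k := by
    intro n hn
    have : Nat.finMulAntidiag k n ⊆ Fintype.piFinset (fun _ : Fin k => n.divisors) := by
      intro f hf
      rw [Fintype.mem_piFinset]
      intro i
      exact Nat.mem_divisors.2 ⟨Nat.dvd_of_mem_finMulAntidiag hf i, hn⟩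
    simpa [divisorFn] using Finset.card_le_card this
  have hp1 : (1 : ℝ) < p := by exact_mod_cast hp.one_lt
  have hr : ‖((p : ℝ)⁻¹)‖ < 1 := by
    rw [norm_inv, Real.norm_of_nonneg (by positivity)]
    exact inv_lt_one_of_one_lt₀ hp1
  have h1 : Summable (fun n : ℕ => ((n + 1 : ℕ) : ℝ) ^ k * ((p : ℝ)⁻¹) ^ (n + 1)) :=
    (summable_nat_add_iff (f := fun n : ℕ => (n : ℝ) ^ k * ((p : ℝ)⁻¹) ^ n) 1).2
      (summable_pow_mul_geometric_of_norm_lt_one k hr)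
  have h3 : ∀ n : ℕ, (divisorFn k (p ^ n) : ℝ) ≤ ((n + 1 : ℕ) : ℝ) ^ k := by
    intro n
    have := hb (p ^ n) (pow_ne_zero _ hp.ne_zero)
    rw [Nat.divisors_prime_pow hp, Finset.card_map, Finset.card_range] at this
    exact_mod_cast this
  have h2 : Summable (fun n : ℕ => (divisorFn k (p ^ n) : ℝ) * ((p : ℝ)⁻¹) ^ n) := by
    refine Summable.of_nonneg_of_le
      (fun n => mul_nonneg (Nat.cast_nonneg _) (pow_nonneg (by positivity) _)) (fun n => ?_)
      (h1.mul_left (p : ℝ))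
    have h4 : (p : ℝ) * (((n + 1 : ℕ) : ℝ) ^ k * ((p : ℝ)⁻¹) ^ (n + 1))
        = ((n + 1 : ℕ) : ℝ) ^ k * ((p : ℝ)⁻¹) ^ n := by
      have hp0 : (p : ℝ) * (p : ℝ)⁻¹ = 1 := mul_inv_cancel₀ (by positivity)
      rw [pow_succ]
      linear_combination (((n + 1 : ℕ) : ℝ) ^ k * ((p : ℝ)⁻¹) ^ n) * hp0
    rw [h4]
    exact mul_le_mul_of_nonneg_right (h3 n) (pow_nonneg (by positivity) _)
  have h5 := (summable_nat_add_iff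
    (f := fun n : ℕ => (divisorFn k (p ^ n) : ℝ) * ((p : ℝ)⁻¹) ^ n) α).2 h2
  refine h5.congr fun j => ?_
  rw [add_comm α j]

/-- The arithmetic function `n ↦ 1 / n`. -/
noncomputable def invFn : ArithmeticFunction ℝ := ⟨fun n => (n : ℝ)⁻¹, by simp⟩

/-- The arithmetic function `n ↦ μ(n) / n`. -/
noncomputable def moebiusInvFn : ArithmeticFunction ℝ :=
  ⟨fun n => (ArithmeticFunction.moebius n : ℝ) * (n : ℝ)⁻¹, by simp⟩

theorem invFn_apply (n : ℕ) : invFn n = (n : ℝ)⁻¹ := rfl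

theorem moebiusInvFn_apply (n : ℕ) :
    moebiusInvFn n = (ArithmeticFunction.moebius n : ℝ) * (n : ℝ)⁻¹ := rfl

theorem invFn_mul_moebiusInvFn : invFn * moebiusInvFn = 1 := by
  ext n
  have h1 : (invFn * moebiusInvFn) n = (n : ℝ)⁻¹ *
      ((ArithmeticFunction.zeta : ArithmeticFunction ℝ) *
        (ArithmeticFunction.moebius : ArithmeticFunction ℝ)) n := by
    rw [ArithmeticFunction.mul_apply, ArithmeticFunction.mul_apply, Finset.mul_sum]
    refine Finset.sum_congr rfl fun x hx => ?_
    have h0 := Nat.left_ne_zero_of_mem_divisorsAntidiagonal hx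
    obtain ⟨rfl, -⟩ := Nat.mem_divisorsAntidiagonal.1 hx
    simp only [invFn_apply, moebiusInvFn_apply, ArithmeticFunction.natCoe_apply,
      ArithmeticFunction.intCoe_apply, ArithmeticFunction.zeta_apply, h0, if_false]
    push_cast
    rw [mul_inv]
    ring
  rw [h1, ArithmeticFunction.coe_zeta_mul_coe_moebius]
  by_cases hn : n = 1
  · simp [hn]
  · simp [ArithmeticFunction.one_apply_ne hn]

theorem isMultiplicative_moebiusInvFn : moebiusInvFn.IsMultiplicative := by
  refine ⟨by simp [moebiusInvFn_apply], fun {m n} hmn => ?_⟩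
  simp only [moebiusInvFn_apply,
    ArithmeticFunction.isMultiplicative_moebius.map_mul_of_coprime hmn]
  push_cast
  rw [mul_inv]
  ring

theorem isMultiplicative_invFn : invFn.IsMultiplicative := by
  refine ⟨by simp [invFn_apply], fun {m n} _ => ?_⟩
  simp only [invFn_apply]
  push_cast
  rw [mul_inv]

theorem divisorFn_zero_left (n : ℕ) : divisorFn 0 n = if n = 1 then 1 else 0 := by
  split_ifs with h
  · subst h; simp [divisorFn, Nat.finMulAntidiag_one]
  · simp [divisorFn, Nat.finMulAntidiag_zero_left h]

theorem divisorFn_one_right (k : ℕ) : divisorFn k 1 = 1 := by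
  simp [divisorFn, Nat.finMulAntidiag_one]

theorem divisorFn_zero_right (k : ℕ) : divisorFn k 0 = 0 := by
  simp [divisorFn]

theorem divisorFn_succ (k n : ℕ) :
    divisorFn (k + 1) n = ∑ x ∈ n.divisorsAntidiagonal, divisorFn k x.2 := by
  simp only [divisorFn]
  rw [← Finset.card_sigma]
  symm
  refine Finset.card_bij' (fun s _ => Fin.cons s.1.1 s.2)
    (fun f _ => ⟨(f 0, ∏ i : Fin k, f i.succ), fun i => f i.succ⟩) ?_ ?_ ?_ ?_
  · rintro ⟨⟨a, b⟩, f⟩ hs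
    simp only [Finset.mem_sigma, Nat.mem_divisorsAntidiagonal, Nat.mem_finMulAntidiag] at hs
    simp only [Nat.mem_finMulAntidiag, Fin.prod_univ_succ, Fin.cons_zero, Fin.cons_succ]
    exact ⟨by rw [hs.2.1]; exact hs.1.1, hs.1.2⟩
  · intro f hf
    rw [Nat.mem_finMulAntidiag, Fin.prod_univ_succ] at hf
    simp only [Finset.mem_sigma, Nat.mem_divisorsAntidiagonal, Nat.mem_finMulAntidiag]
    refine ⟨hf, trivial, fun h0 => hf.2 ?_⟩
    rw [← hf.1, h0, mul_zero]
  · rintro ⟨⟨a, b⟩, f⟩ hs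
    simp only [Finset.mem_sigma, Nat.mem_divisorsAntidiagonal, Nat.mem_finMulAntidiag] at hs
    simp [hs.2.1]
  · intro f _
    exact Fin.cons_self_tail f

theorem invFn_pow_apply (k n : ℕ) : (invFn ^ k) n = (divisorFn k n : ℝ) * (n : ℝ)⁻¹ := by
  induction k generalizing n with
  | zero =>
    rw [pow_zero, ArithmeticFunction.one_apply, divisorFn_zero_left]
    split_ifs with h <;> simp [h]
  | succ k ih =>
    rw [pow_succ', ArithmeticFunction.mul_apply, divisorFn_succ, Nat.cast_sum, Finset.sum_mul]
    refine Finset.sum_congr rfl fun x hx => ?_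
    obtain ⟨rfl, -⟩ := Nat.mem_divisorsAntidiagonal.1 hx
    rw [ih, invFn_apply]
    push_cast
    rw [mul_inv]
    ring

theorem divisorFn_mul_of_coprime (k : ℕ) {m n : ℕ} (hmn : m.Coprime n) :
    (divisorFn k (m * n) : ℝ) = divisorFn k m * divisorFn k n := by
  rcases eq_or_ne m 0 with rfl | hm
  · simp [divisorFn_zero_right]
  rcases eq_or_ne n 0 with rfl | hn
  · simp [divisorFn_zero_right]
  have h := (isMultiplicative_invFn.pow (k := k)).map_mul_of_coprime hmn
  simp only [invFn_pow_apply, Nat.cast_mul] at h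
  have hm' : (m : ℝ) ≠ 0 := Nat.cast_ne_zero.2 hm
  have hn' : (n : ℝ) ≠ 0 := Nat.cast_ne_zero.2 hn
  field_simp at h
  linarith

/-- The Dirichlet convolution with `u` in the first of two variables. -/
noncomputable def convFst (u : ArithmeticFunction ℝ) (F : ℕ → ℕ → ℝ) (n q : ℕ) : ℝ :=
  ∑ x ∈ n.divisorsAntidiagonal, u x.1 * F x.2 q

/-- The Dirichlet convolution with `u` in the second of two variables. -/
noncomputable def convSnd (u : ArithmeticFunction ℝ) (F : ℕ → ℕ → ℝ) (n q : ℕ) : ℝ :=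
  ∑ x ∈ q.divisorsAntidiagonal, u x.1 * F n x.2

theorem convSnd_eq (u : ArithmeticFunction ℝ) (F : ℕ → ℕ → ℝ) (n q : ℕ) :
    convSnd u F n q = convFst u (fun a b => F b a) q n := rfl

theorem convFst_mul (u v : ArithmeticFunction ℝ) (F : ℕ → ℕ → ℝ) :
    convFst (u * v) F = convFst u (convFst v F) := by
  ext n q
  let f : ArithmeticFunction ℝ := ⟨fun n => if n = 0 then 0 else F n q, by simp⟩
  have key : ∀ (w : ArithmeticFunction ℝ) (n : ℕ), convFst w F n q = (w * f) n := by
    intro w n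
    rw [ArithmeticFunction.mul_apply]
    refine Finset.sum_congr rfl fun x hx => ?_
    have h0 := Nat.right_ne_zero_of_mem_divisorsAntidiagonal hx
    simp [f, h0]
  rw [key, mul_assoc, ArithmeticFunction.mul_apply]
  simp only [convFst]
  refine Finset.sum_congr rfl fun x _ => ?_
  rw [← key]
  rfl

theorem convFst_one (F : ℕ → ℕ → ℝ) {n : ℕ} (q : ℕ) (hn : n ≠ 0) : convFst 1 F n q = F n q := by
  rw [convFst, Finset.sum_eq_single (1, n)]
  · simp
  · rintro ⟨a, b⟩ hx hne
    obtain ⟨rfl, -⟩ := Nat.mem_divisorsAntidiagonal.1 hx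
    have : a ≠ 1 := by rintro rfl; simp at hne
    simp [ArithmeticFunction.one_apply_ne this]
  · intro h
    simp [hn] at h

theorem convSnd_mul (u v : ArithmeticFunction ℝ) (F : ℕ → ℕ → ℝ) :
    convSnd (u * v) F = convSnd u (convSnd v F) := by
  ext n q
  rw [convSnd_eq, convFst_mul]
  rfl

theorem convSnd_one (F : ℕ → ℕ → ℝ) (n : ℕ) {q : ℕ} (hq : q ≠ 0) : convSnd 1 F n q = F n q :=
  convFst_one (fun a b => F b a) n hq

theorem convFst_convSnd_comm (u v : ArithmeticFunction ℝ) (F : ℕ → ℕ → ℝ) :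
    convFst u (convSnd v F) = convSnd v (convFst u F) := by
  ext n q
  simp only [convFst, convSnd, Finset.mul_sum]
  rw [Finset.sum_comm]
  refine Finset.sum_congr rfl fun _ _ => Finset.sum_congr rfl fun _ _ => by ring

theorem sum_Icc_divisorsAntidiagonal (f : ℕ → ℕ → ℝ) (N : ℕ) :
    ∑ n ∈ Finset.Icc 1 N, ∑ x ∈ n.divisorsAntidiagonal, f x.1 x.2
      = ∑ a ∈ Finset.Icc 1 N, ∑ b ∈ Finset.Icc 1 (N / a), f a b := by
  rw [Finset.sum_sigma', Finset.sum_sigma']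
  refine Finset.sum_bij' (fun s _ => ⟨s.2.1, s.2.2⟩) (fun s _ => ⟨s.1 * s.2, (s.1, s.2)⟩)
    ?_ ?_ ?_ ?_ ?_
  · rintro ⟨n, a, b⟩ hs
    simp only [Finset.mem_sigma, Finset.mem_Icc, Nat.mem_divisorsAntidiagonal] at hs ⊢
    obtain ⟨⟨h1, h2⟩, rfl, h3⟩ := hs
    have ha : 0 < a := Nat.pos_of_ne_zero (left_ne_zero_of_mul h3)
    have hb : 0 < b := Nat.pos_of_ne_zero (right_ne_zero_of_mul h3)
    exact ⟨⟨ha, (Nat.le_mul_of_pos_right a hb).trans h2⟩, hb,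
      (Nat.le_div_iff_mul_le ha).2 (by rwa [mul_comm])⟩
  · rintro ⟨a, b⟩ hs
    simp only [Finset.mem_sigma, Finset.mem_Icc, Nat.mem_divisorsAntidiagonal] at hs ⊢
    obtain ⟨⟨h1, h2⟩, h3, h4⟩ := hs
    have := (Nat.le_div_iff_mul_le h1).1 h4
    exact ⟨⟨Nat.mul_pos h1 h3, by rwa [mul_comm]⟩, trivial, (Nat.mul_pos h1 h3).ne'⟩
  · rintro ⟨n, a, b⟩ hs
    simp only [Finset.mem_sigma, Nat.mem_divisorsAntidiagonal] at hs
    obtain ⟨-, rfl, -⟩ := hs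
    rfl
  · rintro ⟨a, b⟩ _
    rfl
  · rintro ⟨n, a, b⟩ _
    rfl

theorem sum_Icc_divisorsAntidiagonal' (f : ℕ → ℕ → ℝ) (N : ℕ) :
    ∑ n ∈ Finset.Icc 1 N, ∑ x ∈ n.divisorsAntidiagonal, f x.1 x.2
      = ∑ b ∈ Finset.Icc 1 N, ∑ a ∈ Finset.Icc 1 (N / b), f a b := by
  rw [← sum_Icc_divisorsAntidiagonal (fun a b => f b a)]
  refine Finset.sum_congr rfl fun n _ => ?_
  conv_lhs => rw [← Nat.map_swap_divisorsAntidiagonal, Finset.sum_map]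
  rfl

theorem divisorFn_succ' (k n : ℕ) :
    divisorFn (k + 1) n = ∑ x ∈ n.divisorsAntidiagonal, divisorFn k x.1 := by
  rw [divisorFn_succ]
  conv_lhs => rw [← Nat.map_swap_divisorsAntidiagonal, Finset.sum_map]
  rfl

theorem divisorFn_succ_divisors (k n : ℕ) :
    divisorFn (k + 1) n = ∑ d ∈ n.divisors, divisorFn k d := by
  rw [divisorFn_succ', Nat.sum_divisorsAntidiagonal (fun i _ => divisorFn k i)]

theorem one_le_divisorFn_succ (k : ℕ) {n : ℕ} (hn : n ≠ 0) : 1 ≤ divisorFn (k + 1) n := by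
  rw [divisorFn_succ_divisors, ← divisorFn_one_right k]
  exact Finset.single_le_sum (f := fun d => divisorFn k d) (fun _ _ => Nat.zero_le _)
    (Nat.one_mem_divisors.2 hn)

/-- The logarithmic sum `∑_{n ≤ y} d_k(n) / n`. -/
noncomputable def divisorLogSum (k : ℕ) (y : ℝ) : ℝ :=
  ∑ n ∈ Finset.Icc 1 ⌊y⌋₊, (divisorFn k n : ℝ) * (n : ℝ)⁻¹

/-- The sum `∑_{n ≤ y} d_k(n)`. -/
noncomputable def divisorSum (k : ℕ) (y : ℝ) : ℝ :=
  ∑ n ∈ Finset.Icc 1 ⌊y⌋₊, (divisorFn k n : ℝ)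

theorem divisorLogSum_nonneg (k : ℕ) (y : ℝ) : 0 ≤ divisorLogSum k y :=
  Finset.sum_nonneg fun _ _ => by positivity

theorem divisorSum_nonneg (k : ℕ) (y : ℝ) : 0 ≤ divisorSum k y :=
  Finset.sum_nonneg fun _ _ => by positivity

theorem divisorLogSum_mono (k : ℕ) {y y' : ℝ} (h : y ≤ y') :
    divisorLogSum k y ≤ divisorLogSum k y' :=
  Finset.sum_le_sum_of_subset_of_nonneg
    (Finset.Icc_subset_Icc_right (Nat.floor_mono h)) fun _ _ _ => by positivity

theorem divisorLogSum_succ (k : ℕ) (y : ℝ) :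
    divisorLogSum (k + 1) y
      = ∑ a ∈ Finset.Icc 1 ⌊y⌋₊, (a : ℝ)⁻¹ * divisorLogSum k (y / a) := by
  simp only [divisorLogSum, Nat.floor_div_natCast, Finset.mul_sum]
  rw [← sum_Icc_divisorsAntidiagonal
    (fun a b => (a : ℝ)⁻¹ * ((divisorFn k b : ℝ) * (b : ℝ)⁻¹))]
  refine Finset.sum_congr rfl fun n _ => ?_
  rw [divisorFn_succ, Nat.cast_sum, Finset.sum_mul]
  refine Finset.sum_congr rfl fun x hx => ?_
  obtain ⟨rfl, -⟩ := Nat.mem_divisorsAntidiagonal.1 hx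
  push_cast
  rw [mul_inv]
  ring

theorem divisorSum_succ (k : ℕ) (y : ℝ) :
    divisorSum (k + 1) y
      = ∑ a ∈ Finset.Icc 1 ⌊y⌋₊, (divisorFn k a : ℝ) * (⌊y / a⌋₊ : ℝ) := by
  have h : ∀ a : ℕ, (divisorFn k a : ℝ) * (⌊y / a⌋₊ : ℝ)
      = ∑ _b ∈ Finset.Icc 1 (⌊y⌋₊ / a), (divisorFn k a : ℝ) := by
    intro a
    rw [Finset.sum_const, Nat.card_Icc, Nat.floor_div_natCast, nsmul_eq_mul]
    simp [mul_comm]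
  simp only [divisorSum, h]
  rw [← sum_Icc_divisorsAntidiagonal (fun a _ => (divisorFn k a : ℝ))]
  exact Finset.sum_congr rfl fun n _ => by rw [divisorFn_succ', Nat.cast_sum]

theorem divisorSum_succ_le (k : ℕ) {y : ℝ} (hy : 0 ≤ y) :
    divisorSum (k + 1) y ≤ y * divisorLogSum k y := by
  rw [divisorSum_succ, divisorLogSum, Finset.mul_sum]
  refine Finset.sum_le_sum fun a _ => ?_
  have := Nat.floor_le (a := y / a) (by positivity)
  calc (divisorFn k a : ℝ) * (⌊y / a⌋₊ : ℝ) ≤ divisorFn k a * (y / a) := by gcongr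
    _ = _ := by rw [div_eq_mul_inv]; ring

theorem le_divisorSum_succ (k : ℕ) (y : ℝ) :
    y * divisorLogSum k y - divisorSum k y ≤ divisorSum (k + 1) y := by
  rw [divisorSum_succ, divisorLogSum, Finset.mul_sum, divisorSum, ← Finset.sum_sub_distrib]
  refine Finset.sum_le_sum fun a _ => ?_
  have := Nat.sub_one_lt_floor (y / a)
  calc y * (divisorFn k a * (a : ℝ)⁻¹) - divisorFn k a
      = divisorFn k a * (y / a - 1) := by rw [div_eq_mul_inv]; ring
    _ ≤ _ := by gcongr

theorem pow_succ_sub_pow_succ_le (k : ℕ) {u v : ℝ} (hv : 0 ≤ v) (hvu : v ≤ u) :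
    u ^ (k + 1) - v ^ (k + 1) ≤ (k + 1) * (u - v) * u ^ k := by
  induction k with
  | zero => simp
  | succ k ih =>
    have h1 : v ^ (k + 1) ≤ u ^ (k + 1) := pow_le_pow_left₀ hv hvu _
    have h2 := mul_le_mul_of_nonneg_left ih (hv.trans hvu)
    have h3 := mul_le_mul_of_nonneg_left h1 (sub_nonneg.2 hvu)
    push_cast
    rw [pow_succ u (k + 1), pow_succ v (k + 1)]
    rw [pow_succ u k] at *
    nlinarith

theorem le_pow_succ_sub_pow_succ (k : ℕ) {u v : ℝ} (hv : 0 ≤ v) (hvu : v ≤ u) :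
    (k + 1) * (u - v) * v ^ k ≤ u ^ (k + 1) - v ^ (k + 1) := by
  induction k with
  | zero => simp
  | succ k ih =>
    have h1 : v ^ (k + 1) ≤ u ^ (k + 1) := pow_le_pow_left₀ hv hvu _
    have h2 := mul_le_mul_of_nonneg_left ih hv
    have h3 := mul_le_mul_of_nonneg_left h1 (sub_nonneg.2 hvu)
    push_cast
    rw [pow_succ u (k + 1), pow_succ v (k + 1)]
    rw [pow_succ v k] at *
    nlinarith

theorem log_pow_succ_le_sum (k : ℕ) {y : ℝ} (hy : 1 ≤ y) :
    Real.log y ^ (k + 1)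
      ≤ (k + 1) * ∑ a ∈ Finset.Icc 1 ⌊y⌋₊, (a : ℝ)⁻¹ * Real.log (y / a) ^ k := by
  have hy0 : 0 < y := by linarith
  have key : ∀ N : ℕ, (N : ℝ) ≤ y →
      Real.log y ^ (k + 1) - (max 0 (Real.log (y / (N + 1 : ℕ)))) ^ (k + 1)
        ≤ (k + 1) * ∑ a ∈ Finset.Icc 1 N, (a : ℝ)⁻¹ * Real.log (y / a) ^ k := by
    intro N
    induction N with
    | zero =>
      intro _
      simp [max_eq_right (Real.log_nonneg hy)]
    | succ N ih =>
      intro hN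
      have hN1 : (0 : ℝ) < (N + 1 : ℕ) := by positivity
      have h1 := ih ((by push_cast; linarith : (N : ℝ) ≤ (N + 1 : ℕ)).trans hN)
      rw [Finset.sum_Icc_succ_top (by omega), mul_add]
      have hu : 0 ≤ Real.log (y / (N + 1 : ℕ)) := Real.log_nonneg ((one_le_div hN1).2 hN)
      rw [max_eq_right hu] at h1
      set u := Real.log (y / (N + 1 : ℕ)) with hudef
      set v := max 0 (Real.log (y / (N + 1 + 1 : ℕ))) with hvdef
      have hvu : v ≤ u := by
        refine max_le hu (Real.log_le_log (by positivity) ?_)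
        gcongr
        omega
      have h2 := pow_succ_sub_pow_succ_le k (le_max_left _ _) hvu
      have h3 : u - v ≤ ((N + 1 : ℕ) : ℝ)⁻¹ := by
        have h4 : Real.log (y / (N + 1 + 1 : ℕ)) ≤ v := le_max_right _ _
        rw [Real.log_div hy0.ne' (by positivity)] at h4 hudef
        have h5 := Real.log_le_sub_one_of_pos
          (x := ((N + 1 + 1 : ℕ) : ℝ) / (N + 1 : ℕ)) (by positivity)
        rw [Real.log_div (by positivity) (by positivity)] at h5
        have h6 : ((N + 1 + 1 : ℕ) : ℝ) / (N + 1 : ℕ) - 1 = ((N + 1 : ℕ) : ℝ)⁻¹ := by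
          push_cast
          field_simp
          ring
        linarith
      have h7 : ((k : ℝ) + 1) * (u - v) * u ^ k ≤ (k + 1) * (((N + 1 : ℕ) : ℝ)⁻¹ * u ^ k) := by
        rw [mul_assoc]
        gcongr
      linarith
  have h := key ⌊y⌋₊ (Nat.floor_le hy0.le)
  have h0 : max 0 (Real.log (y / (⌊y⌋₊ + 1 : ℕ))) = 0 := by
    refine max_eq_left (Real.log_nonpos (by positivity) ?_)
    rw [div_le_one (by positivity)]
    push_cast
    exact (Nat.lt_floor_add_one y).le
  rw [h0, zero_pow (by omega), sub_zero] at h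
  exact h

theorem sum_le_log_add_pow_succ (k : ℕ) {y c : ℝ} (hy : 1 ≤ y) (hc : 0 ≤ c) :
    (k + 1) * ∑ a ∈ Finset.Icc 1 ⌊y⌋₊, (a : ℝ)⁻¹ * (Real.log (y / a) + c) ^ k
      ≤ (Real.log y + (c + 1)) ^ (k + 1) := by
  have hy0 : 0 < y := by linarith
  have hL := Real.log_nonneg hy
  have key : ∀ N : ℕ, ((N + 1 : ℕ) : ℝ) ≤ y →
      (k + 1) * ∑ a ∈ Finset.Icc 1 (N + 1), (a : ℝ)⁻¹ * (Real.log (y / a) + c) ^ k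
        ≤ (k + 1) * (Real.log y + c) ^ k + ((Real.log y + c) ^ (k + 1)
          - (Real.log (y / (N + 1 : ℕ)) + c) ^ (k + 1)) := by
    intro N
    induction N with
    | zero => intro _; simp
    | succ N ih =>
      intro hN
      have hN1 : (0 : ℝ) < (N + 1 + 1 : ℕ) := by positivity
      have h1 := ih ((by push_cast; linarith : ((N + 1 : ℕ) : ℝ) ≤ (N + 1 + 1 : ℕ)).trans hN)
      rw [Finset.sum_Icc_succ_top (by omega), mul_add]
      have hu : 0 ≤ Real.log (y / (N + 1 + 1 : ℕ)) := Real.log_nonneg ((one_le_div hN1).2 hN)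
      have huv : Real.log (y / (N + 1 : ℕ)) - Real.log (y / (N + 1 + 1 : ℕ))
          ≥ ((N + 1 + 1 : ℕ) : ℝ)⁻¹ := by
        have h5 := Real.one_sub_inv_le_log_of_pos
          (x := ((N + 1 + 1 : ℕ) : ℝ) / (N + 1 : ℕ)) (by positivity)
        rw [Real.log_div (by positivity) (by positivity)] at h5
        rw [Real.log_div hy0.ne' (by positivity), Real.log_div hy0.ne' (by positivity)]
        have h6 : 1 - (((N + 1 + 1 : ℕ) : ℝ) / (N + 1 : ℕ))⁻¹ = ((N + 1 + 1 : ℕ) : ℝ)⁻¹ := by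
          push_cast
          field_simp
          ring
        linarith
      set u := Real.log (y / (N + 1 + 1 : ℕ))
      set v := Real.log (y / (N + 1 : ℕ))
      have h0 : 0 ≤ ((N + 1 + 1 : ℕ) : ℝ)⁻¹ := by positivity
      have h2 := le_pow_succ_sub_pow_succ k (u := v + c) (v := u + c) (by linarith) (by linarith)
      have h7 : ((k : ℝ) + 1) * (((N + 1 + 1 : ℕ) : ℝ)⁻¹ * (u + c) ^ k)
          ≤ (k + 1) * (v + c - (u + c)) * (u + c) ^ k := by
        rw [mul_assoc]
        have : 0 ≤ u + c := by linarith
        gcongr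
        linarith
      linarith
  have hf : 1 ≤ ⌊y⌋₊ := (Nat.one_le_floor_iff y).2 hy
  obtain ⟨N, hN⟩ : ∃ N, ⌊y⌋₊ = N + 1 := ⟨⌊y⌋₊ - 1, by omega⟩
  have hNy : ((N + 1 : ℕ) : ℝ) ≤ y := hN ▸ Nat.floor_le hy0.le
  have h := key N hNy
  rw [hN]
  have h2 := le_pow_succ_sub_pow_succ k (u := Real.log y + (c + 1)) (v := Real.log y + c)
    (by linarith) (by linarith)
  have h3 : 0 ≤ (Real.log (y / (N + 1 : ℕ)) + c) ^ (k + 1) := by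
    have := Real.log_nonneg ((one_le_div (by positivity)).2 hNy)
    positivity
  have h4 : Real.log y + (c + 1) - (Real.log y + c) = 1 := by ring
  rw [h4, mul_one] at h2
  linarith

theorem log_pow_le_divisorLogSum (k : ℕ) {y : ℝ} (hy : 1 ≤ y) :
    Real.log y ^ k / (k.factorial : ℝ) ≤ divisorLogSum k y := by
  induction k generalizing y with
  | zero =>
    have hf : 1 ≤ ⌊y⌋₊ := (Nat.one_le_floor_iff y).2 hy
    rw [divisorLogSum]
    refine le_trans ?_ (Finset.single_le_sum (f := fun n : ℕ => (divisorFn 0 n : ℝ) * (n : ℝ)⁻¹)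
      (fun _ _ => by positivity) (Finset.mem_Icc.2 ⟨le_rfl, hf⟩))
    simp [divisorFn_one_right]
  | succ k ih =>
    rw [divisorLogSum_succ]
    have h := log_pow_succ_le_sum k hy
    have h1 : ∑ a ∈ Finset.Icc 1 ⌊y⌋₊, (a : ℝ)⁻¹ * Real.log (y / a) ^ k
        ≤ k.factorial * ∑ a ∈ Finset.Icc 1 ⌊y⌋₊, (a : ℝ)⁻¹ * divisorLogSum k (y / a) := by
      rw [Finset.mul_sum]
      refine Finset.sum_le_sum fun a ha => ?_
      obtain ⟨ha1, ha2⟩ := Finset.mem_Icc.1 ha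
      have hay : (a : ℝ) ≤ y := (Nat.le_floor_iff (by linarith)).1 ha2
      have h2 := ih (y := y / a) ((one_le_div (by exact_mod_cast ha1)).2 hay)
      rw [div_le_iff₀ (by positivity)] at h2
      calc (a : ℝ)⁻¹ * Real.log (y / a) ^ k
          ≤ (a : ℝ)⁻¹ * (divisorLogSum k (y / a) * k.factorial) := by gcongr
        _ = _ := by ring
    rw [div_le_iff₀ (by positivity), Nat.factorial_succ]
    push_cast
    nlinarith

theorem divisorLogSum_le (k : ℕ) {y : ℝ} (hy : 1 ≤ y) :
    divisorLogSum k y ≤ (Real.log y + k) ^ k / (k.factorial : ℝ) := by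
  induction k generalizing y with
  | zero =>
    rw [divisorLogSum]
    simp only [divisorFn_zero_left, Nat.cast_ite, Nat.cast_one, Nat.cast_zero, ite_mul, one_mul,
      zero_mul, Finset.sum_ite_eq']
    split_ifs <;> simp
  | succ k ih =>
    rw [divisorLogSum_succ]
    have h := sum_le_log_add_pow_succ k hy (Nat.cast_nonneg k)
    have h1 : k.factorial * ∑ a ∈ Finset.Icc 1 ⌊y⌋₊, (a : ℝ)⁻¹ * divisorLogSum k (y / a)
        ≤ ∑ a ∈ Finset.Icc 1 ⌊y⌋₊, (a : ℝ)⁻¹ * (Real.log (y / a) + k) ^ k := by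
      rw [Finset.mul_sum]
      refine Finset.sum_le_sum fun a ha => ?_
      obtain ⟨ha1, ha2⟩ := Finset.mem_Icc.1 ha
      have hay : (a : ℝ) ≤ y := (Nat.le_floor_iff (by linarith)).1 ha2
      have h2 := ih (y := y / a) ((one_le_div (by exact_mod_cast ha1)).2 hay)
      rw [le_div_iff₀ (by positivity)] at h2
      calc _ = (a : ℝ)⁻¹ * (divisorLogSum k (y / a) * k.factorial) := by ring
        _ ≤ _ := by gcongr
    rw [le_div_iff₀ (by positivity), Nat.factorial_succ]
    push_cast
    nlinarith

theorem tendsto_divisorLogSum (k : ℕ) :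
    Tendsto (fun y => divisorLogSum k y / Real.log y ^ k) atTop
      (nhds (1 / (k.factorial : ℝ))) := by
  have hlog := Real.tendsto_log_atTop
  have h1 : Tendsto (fun y => (1 + k / Real.log y) ^ k / (k.factorial : ℝ)) atTop
      (nhds (1 / (k.factorial : ℝ))) := by
    have : Tendsto (fun y => (k : ℝ) / Real.log y) atTop (nhds 0) :=
      hlog.const_div_atTop _
    simpa using ((this.const_add 1).pow k).div_const (k.factorial : ℝ)
  refine tendsto_of_tendsto_of_tendsto_of_le_of_le' tendsto_const_nhds h1 ?_ ?_
  · filter_upwards [eventually_gt_atTop 1] with y hy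
    have hL := Real.log_pos hy
    rw [le_div_iff₀ (by positivity)]
    have := log_pow_le_divisorLogSum k hy.le
    calc _ = _ := by ring
      _ ≤ _ := this
  · filter_upwards [eventually_gt_atTop 1] with y hy
    have hL := Real.log_pos hy
    rw [div_le_iff₀ (by positivity)]
    refine (divisorLogSum_le k hy.le).trans_eq ?_
    rw [div_mul_eq_mul_div, ← mul_pow]
    congr 2
    field_simp

theorem tendsto_divisorSum_div (k : ℕ) :
    Tendsto (fun y => divisorSum k y / (y * Real.log y ^ k)) atTop (nhds 0) := by
  cases k with
  | zero =>
    have h : ∀ y : ℝ, 1 ≤ y → (1 : ℝ) / y = divisorSum 0 y / (y * Real.log y ^ 0) := by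
      intro y hy
      simp [divisorSum, divisorFn_zero_left, hy]
    refine (tendsto_const_nhds.div_atTop tendsto_id : Tendsto (fun y : ℝ => (1 : ℝ) / y) _ _).congr' ?_
    filter_upwards [eventually_ge_atTop 1] with y hy using h y hy
  | succ k =>
    have h1 : Tendsto (fun y => divisorLogSum k y / Real.log y ^ k * (Real.log y)⁻¹) atTop
        (nhds 0) := by
      simpa using (tendsto_divisorLogSum k).mul Real.tendsto_log_atTop.inv_tendsto_atTop
    refine tendsto_of_tendsto_of_tendsto_of_le_of_le' tendsto_const_nhds h1 ?_ ?_
    · filter_upwards [eventually_gt_atTop 1] with y hy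
      have hL := Real.log_pos hy
      have := divisorSum_nonneg (k + 1) y
      positivity
    · filter_upwards [eventually_gt_atTop 1] with y hy
      have hL := Real.log_pos hy
      have hy0 : 0 < y := by linarith
      rw [div_le_iff₀ (by positivity)]
      refine (divisorSum_succ_le k hy0.le).trans_eq ?_
      field_simp
      ring

theorem tendsto_divisorSum_succ (k : ℕ) :
    Tendsto (fun y => divisorSum (k + 1) y / (y * Real.log y ^ k)) atTop
      (nhds (1 / (k.factorial : ℝ))) := by
  have h1 : Tendsto (fun y => divisorLogSum k y / Real.log y ^ k
      - divisorSum k y / (y * Real.log y ^ k)) atTop (nhds (1 / (k.factorial : ℝ))) := by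
    simpa using (tendsto_divisorLogSum k).sub (tendsto_divisorSum_div k)
  refine tendsto_of_tendsto_of_tendsto_of_le_of_le' h1 (tendsto_divisorLogSum k) ?_ ?_
  · filter_upwards [eventually_gt_atTop 1] with y hy
    have hL := Real.log_pos hy
    have hy0 : 0 < y := by linarith
    rw [le_div_iff₀ (by positivity)]
    refine le_of_eq_of_le ?_ (le_divisorSum_succ k y)
    field_simp
  · filter_upwards [eventually_gt_atTop 1] with y hy
    have hL := Real.log_pos hy
    have hy0 : 0 < y := by linarith
    rw [div_le_iff₀ (by positivity)]
    refine (divisorSum_succ_le k hy0.le).trans_eq ?_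
    field_simp

/-- A function of two variables that is multiplicative over pairs supported on disjoint sets of
primes. -/
structure BiMultiplicative (F : ℕ → ℕ → ℝ) : Prop where
  one : F 1 1 = 1
  mul : ∀ a a' c c' : ℕ, (a * c).Coprime (a' * c') → F (a * a') (c * c') = F a c * F a' c'

theorem sum_divisorsAntidiagonal_mul {m n : ℕ} (cop : m.Coprime n) (f : ℕ → ℕ → ℝ) :
    ∑ x ∈ (m * n).divisorsAntidiagonal, f x.1 x.2
      = ∑ y ∈ m.divisorsAntidiagonal, ∑ z ∈ n.divisorsAntidiagonal,
          f (y.1 * z.1) (y.2 * z.2) := by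
  rw [← Finset.sum_product']
  symm
  apply Finset.sum_nbij fun ((i, j), k, l) ↦ (i * k, j * l)
  · rintro ⟨⟨a1, a2⟩, ⟨b1, b2⟩⟩ h
    simp only [Nat.mem_divisorsAntidiagonal, Ne, Finset.mem_product] at h
    rcases h with ⟨⟨rfl, ha⟩, ⟨rfl, hb⟩⟩
    simp only [Nat.mem_divisorsAntidiagonal, mul_eq_zero, Ne]
    constructor
    · ring
    rw [mul_eq_zero] at *
    exact not_or_intro ha hb
  · rintro ⟨⟨a1, a2⟩, ⟨b1, b2⟩⟩ h ⟨⟨c1, c2⟩, ⟨d1, d2⟩⟩ h' heq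
    simp only [Finset.mem_coe, Nat.mem_divisorsAntidiagonal, Finset.mem_product,
      Prod.mk_inj] at h h' heq
    have hmem : ∀ {x y z w : ℕ}, x * z = m → y * w = n →
        ((x, y) : ℕ × ℕ) ∈ ((m.divisors ×ˢ n.divisors : Finset (ℕ × ℕ)) : Set (ℕ × ℕ)) := by
      intro x y z w hx hy
      rw [Finset.mem_coe, Finset.mem_product, Nat.mem_divisors, Nat.mem_divisors]
      exact ⟨⟨⟨z, hx.symm⟩, h.1.2⟩, ⟨w, hy.symm⟩, h.2.2⟩
    have e1 := cop.mul_injOn_divisors (hmem h.1.1 h.2.1) (hmem h'.1.1 h'.2.1) heq.1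
    have e2 := cop.mul_injOn_divisors
      (hmem ((mul_comm _ _).trans h.1.1) ((mul_comm _ _).trans h.2.1))
      (hmem ((mul_comm _ _).trans h'.1.1) ((mul_comm _ _).trans h'.2.1)) heq.2
    simp only [Prod.mk.injEq] at e1 e2 ⊢
    exact ⟨⟨e1.1, e2.1⟩, e1.2, e2.2⟩
  · simp only [Set.SurjOn, Set.subset_def, Finset.mem_coe, Nat.mem_divisorsAntidiagonal,
      Finset.mem_product, Set.mem_image]
    rintro ⟨b1, b2⟩ h
    use ((b1.gcd m, b2.gcd m), (b1.gcd n, b2.gcd n))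
    rw [← cop.gcd_mul _, ← cop.gcd_mul _, ← h.1, Nat.gcd_mul_gcd_of_coprime_of_mul_eq_mul cop h.1,
      Nat.gcd_mul_gcd_of_coprime_of_mul_eq_mul cop.symm _]
    · rw [Ne, mul_eq_zero, not_or] at h
      simp [h.2.1, h.2.2]
    rw [mul_comm n m, h.1]
  · rintro ⟨⟨a1, a2⟩, ⟨b1, b2⟩⟩ _
    rfl

theorem BiMultiplicative.swap {F : ℕ → ℕ → ℝ} (hF : BiMultiplicative F) :
    BiMultiplicative (fun a b => F b a) :=
  ⟨hF.one, fun a a' c c' h => hF.mul c c' a a' (by rwa [mul_comm c, mul_comm c'])⟩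

theorem BiMultiplicative.convFst {F : ℕ → ℕ → ℝ} (hF : BiMultiplicative F)
    {u : ArithmeticFunction ℝ} (hu : u.IsMultiplicative) : BiMultiplicative (convFst u F) := by
  refine ⟨?_, fun a a' c c' h => ?_⟩
  · simp [_root_.convFst, hu.map_one, hF.one]
  · have haa : a.Coprime a' := h.coprime_mul_right.coprime_mul_right_right
    simp only [_root_.convFst]
    rw [sum_divisorsAntidiagonal_mul haa (fun x y => u x * F y (c * c')), Finset.sum_mul_sum]
    refine Finset.sum_congr rfl fun y hy => Finset.sum_congr rfl fun z hz => ?_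
    obtain ⟨rfl, -⟩ := Nat.mem_divisorsAntidiagonal.1 hy
    obtain ⟨rfl, -⟩ := Nat.mem_divisorsAntidiagonal.1 hz
    rw [hu.map_mul_of_coprime haa.coprime_mul_right.coprime_mul_right_right, hF.mul]
    · ring
    · rw [mul_assoc, mul_assoc] at h
      exact h.coprime_mul_left.coprime_mul_left_right

theorem BiMultiplicative.convSnd {F : ℕ → ℕ → ℝ} (hF : BiMultiplicative F)
    {u : ArithmeticFunction ℝ} (hu : u.IsMultiplicative) : BiMultiplicative (convSnd u F) :=
  (hF.swap.convFst hu).swap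

theorem BiMultiplicative.abs {F : ℕ → ℕ → ℝ} (hF : BiMultiplicative F) :
    BiMultiplicative (fun a c => |F a c|) :=
  ⟨by simp [hF.one], fun a a' c c' h => by rw [hF.mul a a' c c' h, abs_mul]⟩

/-- The sum of `K(a, c)` over the factorizations `a c = n`. -/
noncomputable def diagSum (K : ℕ → ℕ → ℝ) (n : ℕ) : ℝ := ∑ x ∈ n.divisorsAntidiagonal, K x.1 x.2

theorem diagSum_mul {K : ℕ → ℕ → ℝ} (hK : BiMultiplicative K) {m n : ℕ} (h : m.Coprime n) :
    diagSum K (m * n) = diagSum K m * diagSum K n := by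
  simp only [diagSum]
  rw [sum_divisorsAntidiagonal_mul h, Finset.sum_mul_sum]
  refine Finset.sum_congr rfl fun y hy => Finset.sum_congr rfl fun z hz => ?_
  obtain ⟨rfl, -⟩ := Nat.mem_divisorsAntidiagonal.1 hy
  obtain ⟨rfl, -⟩ := Nat.mem_divisorsAntidiagonal.1 hz
  exact hK.mul _ _ _ _ h

theorem diagSum_one {K : ℕ → ℕ → ℝ} (hK : BiMultiplicative K) : diagSum K 1 = 1 := by
  simp [diagSum, hK.one]

theorem diagSum_zero (K : ℕ → ℕ → ℝ) : diagSum K 0 = 0 := by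
  simp [diagSum]

theorem sum_divisorsAntidiagonal_prime_pow {p : ℕ} (hp : p.Prime) (n : ℕ) (f : ℕ → ℕ → ℝ) :
    ∑ x ∈ (p ^ n).divisorsAntidiagonal, f x.1 x.2
      = ∑ x ∈ Finset.HasAntidiagonal.antidiagonal n, f (p ^ x.1) (p ^ x.2) := by
  rw [Nat.sum_divisorsAntidiagonal, Nat.sum_divisors_prime_pow hp,
    Finset.Nat.sum_antidiagonal_eq_sum_range_succ (fun i j => f (p ^ i) (p ^ j))]
  refine Finset.sum_congr rfl fun i hi => ?_
  rw [Nat.pow_div (by have := Finset.mem_range.1 hi; omega) hp.pos]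

theorem diagSum_prime_pow (K : ℕ → ℕ → ℝ) {p : ℕ} (hp : p.Prime) (n : ℕ) :
    diagSum K (p ^ n) = ∑ x ∈ Finset.HasAntidiagonal.antidiagonal n, K (p ^ x.1) (p ^ x.2) :=
  sum_divisorsAntidiagonal_prime_pow hp n K

theorem summable_add_pow_mul_geometric (b A : ℕ) :
    Summable (fun n : ℕ => ((n : ℝ) + b) ^ A * (2⁻¹ : ℝ) ^ n) := by
  have h := (summable_nat_add_iff (f := fun n : ℕ => (n : ℝ) ^ A * (2⁻¹ : ℝ) ^ n) b).2
    (summable_pow_mul_geometric_of_norm_lt_one A (by norm_num))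
  refine (h.mul_left ((2 : ℝ) ^ b)).congr fun n => ?_
  push_cast
  rw [pow_add, mul_left_comm, mul_left_comm _ (_ ^ n), ← mul_pow]
  norm_num

theorem inv_prime_pow_le {p : ℕ} (hp : p.Prime) (n : ℕ) : ((p : ℝ)⁻¹) ^ n ≤ (2⁻¹ : ℝ) ^ n := by
  have : (2 : ℝ) ≤ p := by exact_mod_cast hp.two_le
  gcongr

theorem summable_add_pow_mul_prime_geometric {p : ℕ} (hp : p.Prime) (b A : ℕ) :
    Summable (fun n : ℕ => ((n : ℝ) + b) ^ A * ((p : ℝ)⁻¹) ^ n) :=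
  (summable_add_pow_mul_geometric b A).of_nonneg_of_le (fun _ => by positivity)
    fun n => mul_le_mul_of_nonneg_left (inv_prime_pow_le hp n) (by positivity)

/-- A nonnegative multiplicative function is summable if its values at the primes are `O(p⁻²)` and
its values at prime powers `p ^ n` are `O(n ^ A p ^ (-n))`. -/
theorem summable_of_multiplicative_of_le {E : ℕ → ℝ} (h0 : ∀ n, 0 ≤ E n) (hE0 : E 0 = 0)
    (hE1 : E 1 = 1) (hmul : ∀ {m n : ℕ}, m.Coprime n → E (m * n) = E m * E n) {C : ℝ} (hC : 0 ≤ C)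
    {A : ℕ} (hpow : ∀ p : ℕ, p.Prime → ∀ n : ℕ, E (p ^ n) ≤ C * (((n : ℝ) + 1) ^ A * ((p : ℝ)⁻¹) ^ n))
    (hprime : ∀ p : ℕ, p.Prime → E p ≤ C * ((p : ℝ)⁻¹) ^ 2) : Summable E := by
  have hs : ∀ {p : ℕ}, p.Prime → Summable (fun n : ℕ => E (p ^ n)) := fun {p} hp =>
    ((summable_add_pow_mul_prime_geometric hp 1 A).mul_left C).of_nonneg_of_le (fun _ => h0 _)
      (by simpa using hpow p hp)
  set B : ℝ := ∑' n : ℕ, ((n : ℝ) + 3) ^ A * (2⁻¹ : ℝ) ^ n with hB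
  have hsB : Summable (fun n : ℕ => ((n : ℝ) + 3) ^ A * (2⁻¹ : ℝ) ^ n) := by
    simpa using summable_add_pow_mul_geometric 3 A
  have hB0 : 0 ≤ B := tsum_nonneg fun n => by positivity
  have hlocal : ∀ p : ℕ, p.Prime → ∑' n : ℕ, E (p ^ n) ≤ 1 + C * (1 + B) * ((p : ℝ)⁻¹) ^ 2 := by
    intro p hp
    rw [← (hs hp).sum_add_tsum_nat_add 2, Finset.sum_range_succ, Finset.sum_range_one]
    have h2 : ∑' n : ℕ, E (p ^ (n + 2)) ≤ C * ((p : ℝ)⁻¹) ^ 2 * B := by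
      rw [hB, ← tsum_mul_left]
      refine Summable.tsum_le_tsum (fun n => ?_) ((summable_nat_add_iff 2).2 (hs hp))
        (hsB.mul_left _)
      refine (hpow p hp (n + 2)).trans ?_
      have := inv_prime_pow_le hp n
      push_cast
      rw [pow_add]
      calc C * (((n : ℝ) + 2 + 1) ^ A * (((p : ℝ)⁻¹) ^ n * ((p : ℝ)⁻¹) ^ 2))
          ≤ C * (((n : ℝ) + 2 + 1) ^ A * ((2⁻¹ : ℝ) ^ n * ((p : ℝ)⁻¹) ^ 2)) := by gcongr
        _ = _ := by ring
    have h1 := hprime p hp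
    simp only [pow_zero, pow_one, hE1]
    nlinarith
  have hps : Summable (fun p : Nat.Primes => ((p : ℝ)⁻¹) ^ 2) := by
    refine ((Nat.Primes.summable_rpow (r := -2)).2 (by norm_num)).congr fun p => ?_
    rw [Real.rpow_neg (Nat.cast_nonneg _), Real.rpow_two, ← inv_pow]
  refine summable_of_sum_range_le (c := Real.exp (C * (1 + B) * ∑' p : Nat.Primes, ((p : ℝ)⁻¹) ^ 2))
    h0 fun N => ?_
  have hsm := (EulerProduct.summable_and_hasSum_smoothNumbers_prod_primesBelow_tsum hE1
    (fun {m n} => hmul (m := m) (n := n)) (fun {p} hp => (hs hp).norm) N).2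
  have hind := hasSum_subtype_iff_indicator.1 hsm
  have h3 : ∑ n ∈ Finset.range N, E n ≤ ∏ p ∈ N.primesBelow, ∑' n : ℕ, E (p ^ n) := by
    refine le_trans (le_of_eq (Finset.sum_congr rfl fun n hn => ?_))
      (sum_le_hasSum (Finset.range N) (fun n _ => Set.indicator_nonneg (fun _ _ => h0 _) n) hind)
    rcases Nat.eq_zero_or_pos n with rfl | hn0
    · rw [hE0]
      by_cases h : (0 : ℕ) ∈ N.smoothNumbers <;> simp [Set.indicator, h, hE0]
    · rw [Set.indicator_of_mem (Nat.mem_smoothNumbers_of_lt hn0 (Finset.mem_range.1 hn))]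
  refine h3.trans ?_
  calc ∏ p ∈ N.primesBelow, ∑' n : ℕ, E (p ^ n)
      ≤ ∏ p ∈ N.primesBelow, Real.exp (C * (1 + B) * ((p : ℝ)⁻¹) ^ 2) := by
        refine Finset.prod_le_prod (fun p _ => tsum_nonneg fun n => h0 _) fun p hp => ?_
        refine (hlocal p (Nat.prime_of_mem_primesBelow hp)).trans ?_
        rw [add_comm]
        exact Real.add_one_le_exp _
    _ = Real.exp (C * (1 + B) * ∑ p ∈ N.primesBelow, ((p : ℝ)⁻¹) ^ 2) := by
        rw [← Real.exp_sum, Finset.mul_sum]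
    _ ≤ _ := by
        gcongr
        let s : Finset Nat.Primes := N.primesBelow.subtype Nat.Prime
        have h4 := hps.sum_le_tsum s fun _ _ => by positivity
        refine le_of_eq_of_le ?_ h4
        exact (Finset.sum_subtype_of_mem (p := Nat.Prime) (fun p : ℕ => ((p : ℝ)⁻¹) ^ 2)
          (fun p hp => Nat.prime_of_mem_primesBelow hp)).symm

theorem summable_of_summable_diagSum {K : ℕ → ℕ → ℝ} (hK0 : ∀ n, K 0 n = 0) (hK0' : ∀ n, K n 0 = 0)
    (hs : Summable (diagSum fun a c => |K a c|)) : Summable (fun x : ℕ × ℕ => |K x.1 x.2|) := by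
  refine summable_of_sum_le (c := ∑' n, diagSum (fun a c => |K a c|) n) (fun _ => abs_nonneg _)
    fun s => ?_
  have hd0 : ∀ n, 0 ≤ diagSum (fun a c => |K a c|) n := fun n =>
    Finset.sum_nonneg fun _ _ => abs_nonneg _
  refine le_trans ?_ (hs.sum_le_tsum (s.image fun x => x.1 * x.2) fun n _ => hd0 n)
  simp only [diagSum]
  rw [Finset.sum_sigma']
  have h1 : ∑ x ∈ s, |K x.1 x.2| = ∑ x ∈ s with x.1 * x.2 ≠ 0, |K x.1 x.2| := by
    rw [Finset.sum_filter_of_ne]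
    intro x _ hx h0
    rcases mul_eq_zero.1 h0 with h | h
    · rw [h, hK0, abs_zero] at hx; exact hx rfl
    · rw [h, hK0', abs_zero] at hx; exact hx rfl
  rw [h1]
  refine le_trans (le_of_eq ?_) (Finset.sum_le_sum_of_subset_of_nonneg (s :=
    (s.filter fun x => x.1 * x.2 ≠ 0).map ⟨fun x => (⟨x.1 * x.2, x⟩ : Σ _ : ℕ, ℕ × ℕ), fun x y h => by
      simpa using (Sigma.mk.inj_iff.1 h).2⟩) ?_ fun _ _ _ => abs_nonneg _)
  · rw [Finset.sum_map]
    rfl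
  · intro y hy
    simp only [Finset.mem_map, Finset.mem_filter] at hy
    obtain ⟨x, ⟨hx, hx0⟩, rfl⟩ := hy
    simp only [Finset.mem_sigma, Finset.mem_image, Nat.mem_divisorsAntidiagonal]
    exact ⟨⟨x, hx, rfl⟩, rfl, hx0⟩

theorem hasSum_diagSum {K : ℕ → ℕ → ℝ} (hK0 : ∀ n, K 0 n = 0) (hK0' : ∀ n, K n 0 = 0)
    (hs : Summable (fun x : ℕ × ℕ => K x.1 x.2)) :
    HasSum (diagSum K) (∑' x : ℕ × ℕ, K x.1 x.2) := by
  convert! hs.hasSum.tsum_fiberwise (fun x : ℕ × ℕ => x.1 * x.2) using 2 with n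
  rcases eq_or_ne n 0 with rfl | hn
  · rw [diagSum_zero]
    have h0 : ∀ b : ((fun x : ℕ × ℕ => x.1 * x.2) ⁻¹' {0} : Set (ℕ × ℕ)), K b.1.1 b.1.2 = 0 := by
      rintro ⟨⟨a, c⟩, hb⟩
      rcases mul_eq_zero.1 (show a * c = 0 from hb) with h | h
      · simp [h, hK0]
      · simp [h, hK0']
    simp only [h0, tsum_zero]
  · have : (fun x : ℕ × ℕ => x.1 * x.2) ⁻¹' {n} = (n.divisorsAntidiagonal : Set (ℕ × ℕ)) := by
      ext x
      simp [hn]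
    rw [this, Finset.tsum_subtype' n.divisorsAntidiagonal (fun x : ℕ × ℕ => K x.1 x.2)]
    rfl

theorem tsum_sum_antidiagonal {f : ℕ × ℕ → ℝ} (hf : Summable f) :
    ∑' n, ∑ x ∈ Finset.HasAntidiagonal.antidiagonal n, f x = ∑' x, f x := by
  have h := hf.hasSum.tsum_fiberwise (fun x : ℕ × ℕ => x.1 + x.2)
  rw [← h.tsum_eq]
  refine tsum_congr fun n => ?_
  have : (fun x : ℕ × ℕ => x.1 + x.2) ⁻¹' {n} = (Finset.HasAntidiagonal.antidiagonal n : Set (ℕ × ℕ)) := by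
    ext x
    simp
  rw [this, Finset.tsum_subtype' (Finset.HasAntidiagonal.antidiagonal n) f]

/-- The values at pairs of powers of `p` are `O((i + j)^A p^(-i-j))`, uniformly in `p`. -/
def PrimePowBound (F : ℕ → ℕ → ℝ) : Prop :=
  ∃ C : ℝ, 0 ≤ C ∧ ∃ A : ℕ, ∀ p : ℕ, p.Prime → ∀ i j : ℕ,
    |F (p ^ i) (p ^ j)| ≤ C * (((i : ℝ) + j + 1) ^ A * ((p : ℝ)⁻¹) ^ (i + j))

theorem convFst_prime_pow_zero (u : ArithmeticFunction ℝ) (hu : u 1 = 1) (F : ℕ → ℕ → ℝ) (p q : ℕ) :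
    convFst u F (p ^ 0) q = F 1 q := by
  simp [convFst, hu]

theorem convFst_moebius_prime_pow_succ (F : ℕ → ℕ → ℝ) {p : ℕ} (hp : p.Prime) (i q : ℕ) :
    convFst moebiusInvFn F (p ^ (i + 1)) q = F (p ^ (i + 1)) q - (p : ℝ)⁻¹ * F (p ^ i) q := by
  rw [convFst, sum_divisorsAntidiagonal_prime_pow hp (i + 1) (fun a b => moebiusInvFn a * F b q),
    Finset.Nat.antidiagonal_succ, Finset.sum_cons, Finset.sum_map]
  have h : ∑ x ∈ Finset.HasAntidiagonal.antidiagonal i, moebiusInvFn (p ^ (x.1 + 1)) * F (p ^ x.2) q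
      = - ((p : ℝ)⁻¹ * F (p ^ i) q) := by
    rw [Finset.sum_eq_single (0, i)]
    · simp [moebiusInvFn_apply, ArithmeticFunction.moebius_apply_prime hp]
    · rintro ⟨a, b⟩ hx hne
      rw [Finset.HasAntidiagonal.mem_antidiagonal] at hx
      have ha : a ≠ 0 := by
        rintro rfl
        simp at hx
        simp [hx] at hne
      have : ArithmeticFunction.moebius (p ^ (a + 1)) = 0 := by
        rw [ArithmeticFunction.moebius_apply_prime_pow hp (by omega), if_neg (by omega)]
      simp [moebiusInvFn_apply, this]
    · simp
  simp only [Function.Embedding.prodMap, Function.Embedding.coeFn_mk, Prod.map] at *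
  rw [pow_zero, isMultiplicative_moebiusInvFn.map_one]
  simp only [Nat.succ_eq_add_one, Function.Embedding.refl_apply]
  rw [h]
  ring

theorem PrimePowBound.swap {F : ℕ → ℕ → ℝ} (hF : PrimePowBound F) :
    PrimePowBound (fun a b => F b a) := by
  obtain ⟨C, hC, A, h⟩ := hF
  refine ⟨C, hC, A, fun p hp i j => ?_⟩
  have := h p hp j i
  rwa [add_comm (j : ℝ), add_comm j] at this

theorem PrimePowBound.convFst {F : ℕ → ℕ → ℝ} (hF : PrimePowBound F) :
    PrimePowBound (convFst moebiusInvFn F) := by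
  obtain ⟨C, hC, A, h⟩ := hF
  refine ⟨2 * C, by positivity, A, fun p hp i j => ?_⟩
  cases i with
  | zero =>
    rw [convFst_prime_pow_zero _ isMultiplicative_moebiusInvFn.map_one]
    have h1 := h p hp 0 j
    rw [pow_zero] at h1
    have := (abs_nonneg _).trans h1
    linarith
  | succ i =>
    rw [convFst_moebius_prime_pow_succ F hp]
    have h1 := h p hp (i + 1) j
    have h2 := h p hp i j
    have hp0 : 0 ≤ (p : ℝ)⁻¹ := by positivity
    have h3 : |(p : ℝ)⁻¹ * F (p ^ i) (p ^ j)|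
        ≤ C * ((((i + 1 : ℕ) : ℝ) + j + 1) ^ A * ((p : ℝ)⁻¹) ^ (i + 1 + j)) := by
      rw [abs_mul, abs_of_nonneg hp0]
      calc (p : ℝ)⁻¹ * |F (p ^ i) (p ^ j)|
          ≤ (p : ℝ)⁻¹ * (C * (((i : ℝ) + j + 1) ^ A * ((p : ℝ)⁻¹) ^ (i + j))) := by gcongr
        _ = C * (((i : ℝ) + j + 1) ^ A * ((p : ℝ)⁻¹) ^ (i + 1 + j)) := by ring
        _ ≤ _ := by gcongr; omega
    have := abs_sub (F (p ^ (i + 1)) (p ^ j)) ((p : ℝ)⁻¹ * F (p ^ i) (p ^ j))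
    linarith

theorem PrimePowBound.summable {F : ℕ → ℕ → ℝ} (hF : PrimePowBound F) {p : ℕ} (hp : p.Prime) :
    Summable (fun x : ℕ × ℕ => F (p ^ x.1) (p ^ x.2)) := by
  obtain ⟨C, hC, A, h⟩ := hF
  have hs := summable_add_pow_mul_prime_geometric hp 1 A
  refine Summable.of_norm_bounded (g := fun x : ℕ × ℕ =>
    C * ((((x.1 : ℝ) + (1 : ℕ)) ^ A * ((p : ℝ)⁻¹) ^ x.1) * (((x.2 : ℝ) + (1 : ℕ)) ^ A * ((p : ℝ)⁻¹) ^ x.2)))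
    ((hs.mul_of_nonneg hs (fun _ => by positivity) fun _ => by positivity).mul_left C) fun x => ?_
  refine (h p hp x.1 x.2).trans ?_
  have h1 : (x.1 : ℝ) + x.2 + 1 ≤ ((x.1 : ℝ) + (1 : ℕ)) * ((x.2 : ℝ) + (1 : ℕ)) := by
    have : (0 : ℝ) ≤ (x.1 : ℝ) * x.2 := by positivity
    push_cast
    nlinarith
  calc _ ≤ C * ((((x.1 : ℝ) + (1 : ℕ)) * ((x.2 : ℝ) + (1 : ℕ))) ^ A * ((p : ℝ)⁻¹) ^ (x.1 + x.2)) := by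
        gcongr
    _ = _ := by rw [mul_pow, pow_add]; ring

theorem tsum_convFst_prime_pow {F : ℕ → ℕ → ℝ} (hF : PrimePowBound F) {p : ℕ} (hp : p.Prime) :
    ∑' x : ℕ × ℕ, convFst moebiusInvFn F (p ^ x.1) (p ^ x.2)
      = (1 - (p : ℝ)⁻¹) * ∑' x : ℕ × ℕ, F (p ^ x.1) (p ^ x.2) := by
  have hs := hF.summable hp
  have hs' := hF.convFst.summable hp
  have e : ∀ {G : ℕ → ℕ → ℝ}, Summable (fun x : ℕ × ℕ => G (p ^ x.1) (p ^ x.2)) →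
      ∑' x : ℕ × ℕ, G (p ^ x.1) (p ^ x.2) = ∑' (i : ℕ) (j : ℕ), G (p ^ i) (p ^ j) := fun h => h.tsum_prod
  rw [e hs, e hs']
  have hi : Summable (fun i : ℕ => ∑' j : ℕ, F (p ^ i) (p ^ j)) := hs.prod
  have hi' : Summable (fun i : ℕ => ∑' j : ℕ, convFst moebiusInvFn F (p ^ i) (p ^ j)) := hs'.prod
  have hfib : ∀ i : ℕ, Summable (fun j : ℕ => F (p ^ i) (p ^ j)) := fun i => hs.prod_factor i
  rw [hi'.tsum_eq_zero_add]
  simp only [convFst_prime_pow_zero _ isMultiplicative_moebiusInvFn.map_one,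
    convFst_moebius_prime_pow_succ F hp]
  have h1 : ∀ i : ℕ, ∑' j : ℕ, (F (p ^ (i + 1)) (p ^ j) - (p : ℝ)⁻¹ * F (p ^ i) (p ^ j))
      = ∑' j : ℕ, F (p ^ (i + 1)) (p ^ j) - (p : ℝ)⁻¹ * ∑' j : ℕ, F (p ^ i) (p ^ j) := fun i => by
    rw [(hfib (i + 1)).tsum_sub ((hfib i).mul_left _), tsum_mul_left]
  simp only [h1]
  rw [((summable_nat_add_iff 1).2 hi).tsum_sub (hi.mul_left _), tsum_mul_left]
  rw [sub_mul, one_mul]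
  rw [hi.tsum_eq_zero_add]
  simp only [pow_zero]
  ring

/-- The weight `d_k(n) / n · d_m(q) / φ(q / (h, q))` of the pairs with `(n, q) = (h, q)`. -/
noncomputable def gcdWeight (h k m n q : ℕ) : ℝ :=
  if n.gcd q = h.gcd q then
    (divisorFn k n : ℝ) * (n : ℝ)⁻¹ * ((divisorFn m q : ℝ) / (Nat.totient (q / h.gcd q) : ℝ))
  else 0

theorem gcdWeight_nonneg (h k m n q : ℕ) : 0 ≤ gcdWeight h k m n q := by
  unfold gcdWeight
  split_ifs <;> positivity

theorem gcd_mul_mul_of_coprime {a a' c c' : ℕ} (h : (a * c).Coprime (a' * c')) :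
    (a * a').gcd (c * c') = a.gcd c * a'.gcd c' := by
  have h1 : c.Coprime c' := h.coprime_mul_left.coprime_mul_left_right
  have h2 : c.Coprime a' := h.coprime_mul_left.coprime_mul_right_right
  have h3 : a.Coprime c' := h.coprime_mul_right.coprime_mul_left_right
  rw [h1.gcd_mul, Nat.Coprime.gcd_mul_right_cancel _ h2.symm,
    Nat.Coprime.gcd_mul_left_cancel _ h3]

theorem mul_eq_mul_iff_of_coprime {c c' x x' y y' : ℕ} (h : c.Coprime c') (hx : x ∣ c) (hy : y ∣ c)
    (hx' : x' ∣ c') (hy' : y' ∣ c') : x * x' = y * y' ↔ x = y ∧ x' = y' := by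
  refine ⟨fun e => ⟨?_, ?_⟩, fun e => by rw [e.1, e.2]⟩
  · refine Nat.dvd_antisymm ?_ ?_
    · exact (h.of_dvd hx hy').dvd_of_dvd_mul_right (e ▸ Dvd.intro _ rfl)
    · exact (h.of_dvd hy hx').dvd_of_dvd_mul_right (e ▸ Dvd.intro _ rfl)
  · refine Nat.dvd_antisymm ?_ ?_
    · exact (h.symm.of_dvd hx' hy).dvd_of_dvd_mul_left (e ▸ Dvd.intro_left _ rfl)
    · exact (h.symm.of_dvd hy' hx).dvd_of_dvd_mul_left (e ▸ Dvd.intro_left _ rfl)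

theorem biMultiplicative_gcdWeight (h k m : ℕ) : BiMultiplicative (gcdWeight h k m) := by
  refine ⟨by simp [gcdWeight, divisorFn_one_right], fun a a' c c' cop => ?_⟩
  have hc : c.Coprime c' := cop.coprime_mul_left.coprime_mul_left_right
  have ha : a.Coprime a' := cop.coprime_mul_right.coprime_mul_right_right
  have hg : h.gcd (c * c') = h.gcd c * h.gcd c' := hc.gcd_mul h
  have hiff : (a * a').gcd (c * c') = h.gcd (c * c') ↔ a.gcd c = h.gcd c ∧ a'.gcd c' = h.gcd c' := by
    rw [hg, gcd_mul_mul_of_coprime cop]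
    exact mul_eq_mul_iff_of_coprime hc (Nat.gcd_dvd_right _ _) (Nat.gcd_dvd_right _ _)
      (Nat.gcd_dvd_right _ _) (Nat.gcd_dvd_right _ _)
  have hφ : Nat.totient (c * c' / (h.gcd c * h.gcd c'))
      = Nat.totient (c / h.gcd c) * Nat.totient (c' / h.gcd c') := by
    rw [← Nat.div_mul_div_comm (Nat.gcd_dvd_right _ _) (Nat.gcd_dvd_right _ _)]
    exact Nat.totient_mul (hc.of_dvd (Nat.div_dvd_of_dvd (Nat.gcd_dvd_right _ _))
      (Nat.div_dvd_of_dvd (Nat.gcd_dvd_right _ _)))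
  unfold gcdWeight
  rw [if_congr hiff rfl rfl, hg, hφ, divisorFn_mul_of_coprime k ha, divisorFn_mul_of_coprime m hc]
  by_cases h1 : a.gcd c = h.gcd c <;> by_cases h2 : a'.gcd c' = h.gcd c' <;> simp [h1, h2]
  rw [div_eq_mul_inv, div_eq_mul_inv, div_eq_mul_inv, mul_inv]
  ring

theorem divisorFn_prime_pow_succ (k : ℕ) {p : ℕ} (hp : p.Prime) (n : ℕ) :
    divisorFn (k + 1) (p ^ n) = ∑ i ∈ Finset.range (n + 1), divisorFn k (p ^ i) := by
  rw [divisorFn_succ_divisors, Nat.sum_divisors_prime_pow hp]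

theorem divisorFn_prime_pow_le (k : ℕ) {p : ℕ} (hp : p.Prime) (n : ℕ) :
    divisorFn k (p ^ n) ≤ (n + 1) ^ k := by
  induction k generalizing n with
  | zero =>
    rw [divisorFn_zero_left]
    split_ifs <;> simp
  | succ k ih =>
    rw [divisorFn_prime_pow_succ k hp]
    calc ∑ i ∈ Finset.range (n + 1), divisorFn k (p ^ i)
        ≤ ∑ _i ∈ Finset.range (n + 1), (n + 1) ^ k := by
          refine Finset.sum_le_sum fun i hi => (ih i).trans ?_
          have := Finset.mem_range.1 hi
          gcongr
          omega
      _ = (n + 1) ^ (k + 1) := by simp [pow_succ']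

theorem divisorFn_prime (k : ℕ) {p : ℕ} (hp : p.Prime) : divisorFn k p = k := by
  induction k with
  | zero => rw [divisorFn_zero_left, if_neg hp.ne_one]
  | succ k ih =>
    have := divisorFn_prime_pow_succ k hp 1
    simpa [Finset.sum_range_succ, divisorFn_one_right, ih, add_comm] using this

theorem inv_totient_div_le {p : ℕ} (hp : p.Prime) {g : ℕ} (j : ℕ) (hg : g ∣ p ^ j) :
    ((Nat.totient (p ^ j / g) : ℕ) : ℝ)⁻¹ ≤ 2 * g * ((p : ℝ)⁻¹) ^ j := by
  have hp0 : (0 : ℝ) < p := by exact_mod_cast hp.pos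
  have hp2 : (2 : ℝ) ≤ p := by exact_mod_cast hp.two_le
  obtain ⟨i, hi, rfl⟩ := (Nat.dvd_prime_pow hp).1 hg
  rw [Nat.pow_div hi hp.pos]
  have h1 : ((p : ℝ)) ^ (j - i) ≤ 2 * (Nat.totient (p ^ (j - i)) : ℝ) := by
    rcases Nat.eq_zero_or_pos (j - i) with h0 | h0
    · simp [h0]
    · rw [Nat.totient_prime_pow hp h0]
      obtain ⟨e, he⟩ : ∃ e, j - i = e + 1 := ⟨j - i - 1, by omega⟩
      rw [he, Nat.add_sub_cancel, Nat.cast_mul, Nat.cast_sub hp.one_le]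
      push_cast
      rw [pow_succ]
      have : (0 : ℝ) < (p : ℝ) ^ e := by positivity
      nlinarith
  have h2 : (0 : ℝ) < (Nat.totient (p ^ (j - i)) : ℝ) := by
    exact_mod_cast Nat.totient_pos.2 (pow_pos hp.pos _)
  have h3 : (p : ℝ) ^ j = (p : ℝ) ^ (j - i) * (p : ℝ) ^ i := by rw [← pow_add]; congr 1; omega
  rw [inv_pow, h3, inv_le_iff_one_le_mul₀ h2]
  push_cast
  rw [mul_inv]
  have h4 : (p : ℝ) ^ i * ((p : ℝ) ^ i)⁻¹ = 1 := mul_inv_cancel₀ (by positivity)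
  calc (1 : ℝ) = (p : ℝ) ^ (j - i) * ((p : ℝ) ^ (j - i))⁻¹ := (mul_inv_cancel₀ (by positivity)).symm
    _ ≤ 2 * (Nat.totient (p ^ (j - i)) : ℝ) * ((p : ℝ) ^ (j - i))⁻¹ := by gcongr
    _ = 2 * (Nat.totient (p ^ (j - i)) : ℝ) * ((p : ℝ) ^ (j - i))⁻¹ * ((p : ℝ) ^ i * ((p : ℝ) ^ i)⁻¹) := by
        rw [h4, mul_one]
    _ = _ := by ring

theorem primePowBound_gcdWeight {h : ℕ} (hh : 1 ≤ h) (k m : ℕ) :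
    PrimePowBound (gcdWeight h k m) := by
  refine ⟨2 * h, by positivity, k + m, fun p hp i j => ?_⟩
  rw [abs_of_nonneg (gcdWeight_nonneg _ _ _ _ _)]
  unfold gcdWeight
  split_ifs
  · have h1 : (divisorFn k (p ^ i) : ℝ) ≤ ((i : ℝ) + j + 1) ^ k := by
      have : (divisorFn k (p ^ i) : ℝ) ≤ ((i : ℝ) + 1) ^ k := by
        exact_mod_cast divisorFn_prime_pow_le k hp i
      refine this.trans ?_
      gcongr
      linarith [(Nat.cast_nonneg j : (0 : ℝ) ≤ j)]
    have h2 : (divisorFn m (p ^ j) : ℝ) ≤ ((i : ℝ) + j + 1) ^ m := by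
      have : (divisorFn m (p ^ j) : ℝ) ≤ ((j : ℝ) + 1) ^ m := by
        exact_mod_cast divisorFn_prime_pow_le m hp j
      refine this.trans ?_
      gcongr
      linarith [(Nat.cast_nonneg i : (0 : ℝ) ≤ i)]
    have h3 := inv_totient_div_le hp j (Nat.gcd_dvd_right h (p ^ j))
    have h4 : ((h.gcd (p ^ j) : ℕ) : ℝ) ≤ h := by exact_mod_cast Nat.gcd_le_left _ hh
    rw [div_eq_mul_inv]
    push_cast
    rw [← inv_pow]
    calc _ ≤ ((i : ℝ) + j + 1) ^ k * ((p : ℝ)⁻¹) ^ i *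
          (((i : ℝ) + j + 1) ^ m * (2 * h * ((p : ℝ)⁻¹) ^ j)) := by
          gcongr
          refine h3.trans ?_
          gcongr
      _ = _ := by rw [pow_add, pow_add]; ring
  · positivity

theorem PrimePowBound.convFst_pow {F : ℕ → ℕ → ℝ} (hF : PrimePowBound F) (k : ℕ) :
    PrimePowBound (_root_.convFst (moebiusInvFn ^ k) F) := by
  induction k with
  | zero =>
    obtain ⟨C, hC, A, h⟩ := hF
    refine ⟨C, hC, A, fun p hp i j => ?_⟩
    rw [pow_zero, convFst_one F _ (pow_ne_zero i hp.ne_zero)]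
    exact h p hp i j
  | succ k ih =>
    rw [pow_succ', convFst_mul]
    exact ih.convFst

theorem PrimePowBound.convSnd_pow {F : ℕ → ℕ → ℝ} (hF : PrimePowBound F) (k : ℕ) :
    PrimePowBound (_root_.convSnd (moebiusInvFn ^ k) F) :=
  (hF.swap.convFst_pow k).swap

theorem tsum_convFst_pow_prime_pow {F : ℕ → ℕ → ℝ} (hF : PrimePowBound F) {p : ℕ} (hp : p.Prime)
    (k : ℕ) :
    ∑' x : ℕ × ℕ, convFst (moebiusInvFn ^ k) F (p ^ x.1) (p ^ x.2)
      = (1 - (p : ℝ)⁻¹) ^ k * ∑' x : ℕ × ℕ, F (p ^ x.1) (p ^ x.2) := by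
  induction k with
  | zero =>
    rw [pow_zero, pow_zero, one_mul]
    exact tsum_congr fun x => convFst_one F _ (pow_ne_zero _ hp.ne_zero)
  | succ k ih =>
    rw [pow_succ', convFst_mul, tsum_convFst_prime_pow (hF.convFst_pow k) hp, ih]
    ring

theorem tsum_convSnd_pow_prime_pow {F : ℕ → ℕ → ℝ} (hF : PrimePowBound F) {p : ℕ} (hp : p.Prime)
    (k : ℕ) :
    ∑' x : ℕ × ℕ, convSnd (moebiusInvFn ^ k) F (p ^ x.1) (p ^ x.2)
      = (1 - (p : ℝ)⁻¹) ^ k * ∑' x : ℕ × ℕ, F (p ^ x.1) (p ^ x.2) := by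
  have h := tsum_convFst_pow_prime_pow hF.swap hp k
  rw [← (Equiv.prodComm ℕ ℕ).tsum_eq, ← (Equiv.prodComm ℕ ℕ).tsum_eq (fun x : ℕ × ℕ => F _ _)]
  exact h

theorem convFst_moebius_pow_prime (F : ℕ → ℕ → ℝ) {p : ℕ} (hp : p.Prime) (k q : ℕ) :
    convFst (moebiusInvFn ^ k) F p q = F p q - k * ((p : ℝ)⁻¹ * F 1 q) := by
  induction k with
  | zero => simp [convFst_one F q hp.ne_zero]
  | succ k ih =>
    have h := convFst_moebius_prime_pow_succ (convFst (moebiusInvFn ^ k) F) hp 0 q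
    rw [convFst_prime_pow_zero _ (isMultiplicative_moebiusInvFn.pow).map_one, zero_add, pow_one] at h
    rw [pow_succ', convFst_mul, h, ih]
    push_cast
    ring

theorem convFst_at_one (u : ArithmeticFunction ℝ) (hu : u 1 = 1) (F : ℕ → ℕ → ℝ) (q : ℕ) :
    convFst u F 1 q = F 1 q := by
  simp [convFst, hu]

theorem convSnd_at_one (u : ArithmeticFunction ℝ) (hu : u 1 = 1) (F : ℕ → ℕ → ℝ) (n : ℕ) :
    convSnd u F n 1 = F n 1 := by
  simp [convSnd, hu]

/-- The Dirichlet quotient of `gcdWeight h k m` by `d_k(n) / n · d_m(q) / q`. -/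
noncomputable def gcdKernel (h k m : ℕ) : ℕ → ℕ → ℝ :=
  convFst (moebiusInvFn ^ k) (convSnd (moebiusInvFn ^ m) (gcdWeight h k m))

theorem gcdKernel_zero_left (h k m n : ℕ) : gcdKernel h k m 0 n = 0 := by
  simp [gcdKernel, convFst]

theorem gcdKernel_zero_right (h k m n : ℕ) : gcdKernel h k m n 0 = 0 := by
  simp [gcdKernel, convFst, convSnd]

theorem biMultiplicative_gcdKernel (h k m : ℕ) : BiMultiplicative (gcdKernel h k m) :=
  ((biMultiplicative_gcdWeight h k m).convSnd isMultiplicative_moebiusInvFn.pow).convFst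
    isMultiplicative_moebiusInvFn.pow

theorem primePowBound_gcdKernel {h : ℕ} (hh : 1 ≤ h) (k m : ℕ) : PrimePowBound (gcdKernel h k m) :=
  ((primePowBound_gcdWeight hh k m).convSnd_pow m).convFst_pow k

theorem invFn_pow_mul_moebiusInvFn_pow (k : ℕ) : invFn ^ k * moebiusInvFn ^ k = 1 := by
  rw [← mul_pow, invFn_mul_moebiusInvFn, one_pow]

theorem gcdWeight_eq_conv (h k m : ℕ) {n q : ℕ} (hn : n ≠ 0) (hq : q ≠ 0) :
    gcdWeight h k m n q = convFst (invFn ^ k) (convSnd (invFn ^ m) (gcdKernel h k m)) n q := by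
  rw [gcdKernel, ← convFst_convSnd_comm, ← convFst_mul, invFn_pow_mul_moebiusInvFn_pow,
    convFst_one _ _ hn, ← convSnd_mul, invFn_pow_mul_moebiusInvFn_pow, convSnd_one _ _ hq]

theorem gcdKernel_prime_left (h k m : ℕ) {p : ℕ} (hp : p.Prime) : gcdKernel h k m p 1 = 0 := by
  have hu := (isMultiplicative_moebiusInvFn.pow (k := m)).map_one
  rw [gcdKernel, convFst_moebius_pow_prime _ hp, convSnd_at_one _ hu, convSnd_at_one _ hu,
    (biMultiplicative_gcdWeight h k m).one]
  simp [gcdWeight, divisorFn_one_right, divisorFn_prime k hp]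

theorem abs_gcdKernel_prime_right {h : ℕ} (k m : ℕ) {p : ℕ} (hp : p.Prime) (hph : ¬ p ∣ h) :
    |gcdKernel h k m 1 p| ≤ 2 * m * ((p : ℝ)⁻¹) ^ 2 := by
  have hu := (isMultiplicative_moebiusInvFn.pow (k := k)).map_one
  rw [gcdKernel, convFst_at_one _ hu, convSnd_eq, convFst_moebius_pow_prime _ hp,
    (biMultiplicative_gcdWeight h k m).one]
  have hg : h.gcd p = 1 := ((Nat.Prime.coprime_iff_not_dvd hp).2 hph).symm
  have hp2 : (2 : ℝ) ≤ p := by exact_mod_cast hp.two_le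
  have e : gcdWeight h k m 1 p - m * ((p : ℝ)⁻¹ * 1) = m * ((p : ℝ)⁻¹ / (p - 1)) := by
    have : (p : ℝ) - 1 ≠ 0 := by linarith
    simp only [gcdWeight, hg, Nat.gcd_one_left, if_true, divisorFn_one_right, divisorFn_prime m hp,
      Nat.div_one, Nat.totient_prime hp, Nat.cast_sub hp.one_le, Nat.cast_one]
    field_simp
    ring
  rw [e, abs_of_nonneg (mul_nonneg (Nat.cast_nonneg _) (div_nonneg (by positivity) (by linarith)))]
  have h1 : (p : ℝ)⁻¹ / (p - 1) ≤ 2 * ((p : ℝ)⁻¹) ^ 2 := by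
    rw [div_le_iff₀ (by linarith)]
    have h2 : (p : ℝ)⁻¹ * p = 1 := inv_mul_cancel₀ (by linarith)
    have h3 : (0 : ℝ) < (p : ℝ)⁻¹ := by positivity
    have h4 : 2 * ((p : ℝ)⁻¹) ^ 2 * (p - 1) = (p : ℝ)⁻¹ * (2 * ((p : ℝ)⁻¹ * p) - 2 * (p : ℝ)⁻¹) := by
      ring
    rw [h4, h2]
    have h5 : (p : ℝ)⁻¹ ≤ 2⁻¹ := by gcongr
    nlinarith
  calc (m : ℝ) * ((p : ℝ)⁻¹ / (p - 1)) ≤ m * (2 * ((p : ℝ)⁻¹) ^ 2) := by gcongr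
    _ = _ := by ring

theorem summable_gcdKernel {h : ℕ} (hh : 1 ≤ h) (k m : ℕ) :
    Summable (fun x : ℕ × ℕ => |gcdKernel h k m x.1 x.2|) := by
  have hK := (biMultiplicative_gcdKernel h k m).abs
  obtain ⟨C, hC, A, hb⟩ := primePowBound_gcdKernel hh k m
  have hpow : ∀ p : ℕ, p.Prime → ∀ n : ℕ, diagSum (fun a c => |gcdKernel h k m a c|) (p ^ n)
      ≤ C * (((n : ℝ) + 1) ^ (A + 1) * ((p : ℝ)⁻¹) ^ n) := by
    intro p hp n
    rw [diagSum_prime_pow _ hp]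
    calc _ ≤ ∑ _x ∈ Finset.HasAntidiagonal.antidiagonal n, C * (((n : ℝ) + 1) ^ A * ((p : ℝ)⁻¹) ^ n) := by
          refine Finset.sum_le_sum fun x hx => ?_
          have hx' := Finset.HasAntidiagonal.mem_antidiagonal.1 hx
          refine (hb p hp x.1 x.2).trans (le_of_eq ?_)
          rw [← hx']
          push_cast
          rfl
      _ = _ := by
          rw [Finset.sum_const, Finset.Nat.card_antidiagonal, nsmul_eq_mul]
          push_cast
          ring
  refine summable_of_summable_diagSum (gcdKernel_zero_left h k m) (gcdKernel_zero_right h k m) ?_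
  refine summable_of_multiplicative_of_le (C := C * 2 ^ (A + 1) * h + C + 2 * m) (A := A + 1)
    (fun n => Finset.sum_nonneg fun _ _ => abs_nonneg _) (diagSum_zero _) (diagSum_one hK)
    (fun {m n} hmn => diagSum_mul hK hmn) (by positivity) ?_ ?_
  · intro p hp n
    refine (hpow p hp n).trans ?_
    gcongr
    have : 0 ≤ C * 2 ^ (A + 1) * h := by positivity
    have : (0 : ℝ) ≤ 2 * m := by positivity
    linarith
  · intro p hp
    have hp0 : (0 : ℝ) < p := by exact_mod_cast hp.pos
    by_cases hph : p ∣ h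
    · have h1 := hpow p hp 1
      rw [pow_one, pow_one] at h1
      have h2 : (p : ℝ) ≤ h := by exact_mod_cast Nat.le_of_dvd hh hph
      have h3 : (p : ℝ)⁻¹ ≤ h * ((p : ℝ)⁻¹) ^ 2 := by
        calc (p : ℝ)⁻¹ = p * ((p : ℝ)⁻¹) ^ 2 := by field_simp
          _ ≤ _ := by gcongr
      calc _ ≤ C * ((((1 : ℕ) : ℝ) + 1) ^ (A + 1) * (p : ℝ)⁻¹) := h1
        _ ≤ C * ((((1 : ℕ) : ℝ) + 1) ^ (A + 1) * (h * ((p : ℝ)⁻¹) ^ 2)) := by gcongr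
        _ = C * 2 ^ (A + 1) * h * ((p : ℝ)⁻¹) ^ 2 := by norm_num; ring
        _ ≤ _ := by
          gcongr
          have : (0 : ℝ) ≤ 2 * m := by positivity
          linarith
    · have h1 := abs_gcdKernel_prime_right k m hp hph
      have h2 := diagSum_prime_pow (fun a c => |gcdKernel h k m a c|) hp 1
      rw [pow_one, Finset.Nat.antidiagonal_succ] at h2
      simp [gcdKernel_prime_left h k m hp] at h2
      rw [h2]
      refine h1.trans ?_
      gcongr
      have : 0 ≤ C * 2 ^ (A + 1) * h := by positivity
      linarith

theorem gcd_prime_pow {h p : ℕ} (hh : h ≠ 0) (hp : p.Prime) (j : ℕ) :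
    h.gcd (p ^ j) = p ^ min (h.factorization p) j := by
  have hcop : (h / p ^ h.factorization p).Coprime (p ^ j) :=
    ((Nat.coprime_ordCompl hp hh).pow_left j).symm
  conv_lhs => rw [← Nat.ordProj_mul_ordCompl_eq_self h p]
  rw [Nat.Coprime.gcd_mul_right_cancel _ hcop]
  rcases le_total (h.factorization p) j with h1 | h1
  · rw [min_eq_left h1, Nat.gcd_eq_left (pow_dvd_pow p h1)]
  · rw [min_eq_right h1, Nat.gcd_eq_right (pow_dvd_pow p h1)]

theorem prime_pow_gcd_prime_pow {p : ℕ} (hp : p.Prime) (i j : ℕ) :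
    (p ^ i).gcd (p ^ j) = p ^ min i j := by
  rw [gcd_prime_pow (pow_ne_zero i hp.ne_zero) hp, hp.factorization_pow, Finsupp.single_eq_same]

theorem gcdWeight_prime_pow_of_le {h p : ℕ} (hh : h ≠ 0) (hp : p.Prime) (k m i : ℕ) {j : ℕ}
    (hj : j ≤ h.factorization p) :
    gcdWeight h k m (p ^ i) (p ^ j) = if j ≤ i then
      (divisorFn k (p ^ i) : ℝ) * ((p : ℝ)⁻¹) ^ i * (divisorFn m (p ^ j) : ℝ) else 0 := by
  have hiff : (p ^ i).gcd (p ^ j) = h.gcd (p ^ j) ↔ j ≤ i := by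
    rw [prime_pow_gcd_prime_pow hp, gcd_prime_pow hh hp, min_eq_right hj,
      (Nat.pow_right_injective hp.one_lt).eq_iff, min_eq_right_iff]
  unfold gcdWeight
  rw [if_congr hiff rfl rfl, gcd_prime_pow hh hp, min_eq_right hj,
    Nat.div_self (pow_pos hp.pos _)]
  simp

theorem gcdWeight_prime_pow_of_lt {h p : ℕ} (hh : h ≠ 0) (hp : p.Prime) (k m i : ℕ) {j : ℕ}
    (hj : h.factorization p < j) :
    gcdWeight h k m (p ^ i) (p ^ j) = if i = h.factorization p then
      (1 - (p : ℝ)⁻¹)⁻¹ * ((divisorFn k (p ^ h.factorization p) : ℝ) *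
        ((divisorFn m (p ^ j) : ℝ) * ((p : ℝ)⁻¹) ^ j)) else 0 := by
  have hiff : (p ^ i).gcd (p ^ j) = h.gcd (p ^ j) ↔ i = h.factorization p := by
    rw [prime_pow_gcd_prime_pow hp, gcd_prime_pow hh hp,
      (Nat.pow_right_injective hp.one_lt).eq_iff]
    omega
  unfold gcdWeight
  rw [if_congr hiff rfl rfl, gcd_prime_pow hh hp, min_eq_left hj.le, Nat.pow_div hj.le hp.pos]
  split_ifs with hi
  · rw [hi]
    obtain ⟨e, rfl⟩ : ∃ e, j = h.factorization p + e + 1 := ⟨j - h.factorization p - 1, by omega⟩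
    have hp0 : (p : ℝ) ≠ 0 := by exact_mod_cast hp.ne_zero
    have hp1 : (p : ℝ) - 1 ≠ 0 := sub_ne_zero.2 (by exact_mod_cast hp.ne_one)
    rw [show h.factorization p + e + 1 - h.factorization p = e + 1 by omega,
      Nat.totient_prime_pow_succ hp, Nat.cast_mul, Nat.cast_sub hp.one_le]
    have h1 : 1 - (p : ℝ)⁻¹ = (p - 1) / p := by field_simp
    rw [h1, inv_pow]
    push_cast
    field_simp
    ring
  · rfl

theorem tsum_gcdWeight_prime_pow {h p : ℕ} (hh : 1 ≤ h) (hp : p.Prime) (k m : ℕ) :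
    (1 - (p : ℝ)⁻¹) * ∑' x : ℕ × ℕ, gcdWeight h k m (p ^ x.1) (p ^ x.2)
      = (1 - (p : ℝ)⁻¹) * (∑ α ∈ Finset.Icc 0 (h.factorization p),
          (divisorFn m (p ^ α) : ℝ) * divisorTail k p α)
        + (divisorFn k (p ^ h.factorization p) : ℝ) * divisorTail m p (h.factorization p + 1) := by
  have hh0 : h ≠ 0 := by omega
  have hu : 1 - (p : ℝ)⁻¹ ≠ 0 := by
    have : (1 : ℝ) < p := by exact_mod_cast hp.one_lt
    have := inv_lt_one_of_one_lt₀ this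
    linarith
  set γ := h.factorization p with hγ
  have hs : Summable (fun x : ℕ × ℕ => gcdWeight h k m (p ^ x.2) (p ^ x.1)) :=
    (primePowBound_gcdWeight hh k m).swap.summable hp
  have hsw : ∑' x : ℕ × ℕ, gcdWeight h k m (p ^ x.1) (p ^ x.2)
      = ∑' (j : ℕ) (i : ℕ), gcdWeight h k m (p ^ i) (p ^ j) := by
    rw [← (Equiv.prodComm ℕ ℕ).tsum_eq]
    exact hs.tsum_prod
  have hlow : ∀ j ≤ γ, ∑' i : ℕ, gcdWeight h k m (p ^ i) (p ^ j)
      = (divisorFn m (p ^ j) : ℝ) * divisorTail k p j := by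
    intro j hj
    have hsj : Summable (fun i : ℕ => gcdWeight h k m (p ^ i) (p ^ j)) := hs.prod_factor j
    rw [← hsj.sum_add_tsum_nat_add j, Finset.sum_eq_zero, zero_add, divisorTail, ← tsum_mul_left]
    · refine tsum_congr fun i => ?_
      rw [gcdWeight_prime_pow_of_le hh0 hp k m _ hj, if_pos (by omega), add_comm i j]
      ring
    · intro i hi
      have := Finset.mem_range.1 hi
      rw [gcdWeight_prime_pow_of_le hh0 hp k m _ hj, if_neg (by omega)]
  have hhigh : ∀ j, γ < j → ∑' i : ℕ, gcdWeight h k m (p ^ i) (p ^ j)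
      = (1 - (p : ℝ)⁻¹)⁻¹ * ((divisorFn k (p ^ γ) : ℝ) *
        ((divisorFn m (p ^ j) : ℝ) * ((p : ℝ)⁻¹) ^ j)) := by
    intro j hj
    simp only [gcdWeight_prime_pow_of_lt hh0 hp k m _ hj]
    exact tsum_ite_eq γ _
  have hprod : Summable (fun j : ℕ => ∑' i : ℕ, gcdWeight h k m (p ^ i) (p ^ j)) := hs.prod
  rw [hsw, ← hprod.sum_add_tsum_nat_add (γ + 1)]
  have h1 : ∑ j ∈ Finset.range (γ + 1), ∑' i : ℕ, gcdWeight h k m (p ^ i) (p ^ j)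
      = ∑ α ∈ Finset.Icc 0 γ, (divisorFn m (p ^ α) : ℝ) * divisorTail k p α := by
    rw [Finset.range_eq_Ico, ← Finset.Ico_add_one_right_eq_Icc]
    exact Finset.sum_congr rfl fun j hj => hlow j (by have := Finset.mem_Ico.1 hj; omega)
  have h2 : ∑' j : ℕ, ∑' i : ℕ, gcdWeight h k m (p ^ i) (p ^ (j + (γ + 1)))
      = (1 - (p : ℝ)⁻¹)⁻¹ * ((divisorFn k (p ^ γ) : ℝ) * divisorTail m p (γ + 1)) := by
    rw [divisorTail, ← tsum_mul_left, ← tsum_mul_left]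
    refine tsum_congr fun j => ?_
    rw [hhigh _ (by omega), add_comm j]
  rw [h1, h2, mul_add, mul_inv_cancel_left₀ hu]

theorem divisorTail_zero (k : ℕ) {p : ℕ} (hp : p.Prime) :
    divisorTail k p 0 = ((1 - (p : ℝ)⁻¹) ^ k)⁻¹ := by
  have hp1 : (1 : ℝ) < p := by exact_mod_cast hp.one_lt
  have hr : ‖(p : ℝ)⁻¹‖ < 1 := by
    rw [norm_inv, Real.norm_of_nonneg (by positivity)]
    exact inv_lt_one_of_one_lt₀ hp1
  have hsum : ∀ k, Summable (fun j : ℕ => (divisorFn k (p ^ j) : ℝ) * ((p : ℝ)⁻¹) ^ j) := fun k => by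
    simpa using summable_divisorTail k p 0 hp
  induction k with
  | zero =>
    rw [divisorTail, tsum_eq_single 0]
    · simp [divisorFn_one_right]
    · intro j hj
      have : p ^ (0 + j) ≠ 1 := by
        rw [zero_add]
        exact (Nat.one_lt_pow hj hp.one_lt).ne'
      rw [divisorFn_zero_left, if_neg this, Nat.cast_zero, zero_mul]
  | succ k ih =>
    have h1 := tsum_mul_tsum_eq_tsum_sum_antidiagonal_of_summable_norm (hsum k).norm
      (summable_geometric_of_norm_lt_one hr).norm
    rw [tsum_geometric_of_norm_lt_one hr] at h1
    simp only [divisorTail, zero_add] at ih ⊢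
    rw [pow_succ, mul_inv, ← ih, h1]
    refine tsum_congr fun n => ?_
    rw [divisorFn_prime_pow_succ k hp, Finset.Nat.sum_antidiagonal_eq_sum_range_succ
      (fun i j => (divisorFn k (p ^ i) : ℝ) * ((p : ℝ)⁻¹) ^ i * ((p : ℝ)⁻¹) ^ j), Nat.cast_sum,
      Finset.sum_mul]
    refine Finset.sum_congr rfl fun i hi => ?_
    rw [mul_assoc, ← pow_add]
    congr 2
    have := Finset.mem_range.1 hi
    omega

theorem divisorTail_one (k : ℕ) {p : ℕ} (hp : p.Prime) :
    divisorTail k p 1 = ((1 - (p : ℝ)⁻¹) ^ k)⁻¹ - 1 := by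
  rw [← divisorTail_zero k hp]
  have hs : Summable (fun j : ℕ => (divisorFn k (p ^ (0 + j)) : ℝ) * ((p : ℝ)⁻¹) ^ (0 + j)) :=
    summable_divisorTail k p 0 hp
  rw [divisorTail, divisorTail, hs.tsum_eq_zero_add]
  simp [divisorFn_one_right, add_comm]

theorem one_sub_inv_prime_pos {p : ℕ} (hp : p.Prime) : 0 < 1 - (p : ℝ)⁻¹ := by
  have : (1 : ℝ) < p := by exact_mod_cast hp.one_lt
  have := inv_lt_one_of_one_lt₀ this
  linarith

theorem shiftLocalFactor_denom_eq (k m : ℕ) (u : ℝ) :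
    u ^ (1 - ((k + 1 : ℕ) : ℤ)) + u ^ (1 - ((m + 1 : ℕ) : ℤ)) - 1
      = (u ^ k)⁻¹ + (u ^ m)⁻¹ - 1 := by
  have e : ∀ j : ℕ, (1 - ((j + 1 : ℕ) : ℤ)) = -(j : ℤ) := fun j => by push_cast; ring
  rw [e, e, zpow_neg, zpow_neg, zpow_natCast, zpow_natCast]

theorem shiftLocalFactor_denom_pos (k m : ℕ) {p : ℕ} (hp : p.Prime) :
    0 < ((1 - (p : ℝ)⁻¹) ^ k)⁻¹ + ((1 - (p : ℝ)⁻¹) ^ m)⁻¹ - 1 := by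
  have h1 := one_sub_inv_prime_pos hp
  have h2 : (1 - (p : ℝ)⁻¹) ≤ 1 := by
    have : 0 ≤ (p : ℝ)⁻¹ := by positivity
    linarith
  have h3 : 1 ≤ ((1 - (p : ℝ)⁻¹) ^ k)⁻¹ := (one_le_inv₀ (by positivity)).2 (pow_le_one₀ h1.le h2)
  have h4 : 0 < ((1 - (p : ℝ)⁻¹) ^ m)⁻¹ := by positivity
  linarith

theorem shiftLocalFactor_zero (k m : ℕ) {p : ℕ} (hp : p.Prime) :
    shiftLocalFactor (k + 1) (m + 1) p 0 = 1 := by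
  have hu := one_sub_inv_prime_pos hp
  rw [shiftLocalFactor, shiftLocalFactor_denom_eq]
  rw [div_eq_one_iff_eq (shiftLocalFactor_denom_pos k m hp).ne']
  simp only [Nat.add_sub_cancel, Finset.Icc_self, Finset.sum_singleton, pow_zero,
    divisorFn_one_right, zero_add, divisorTail_zero (k + 1) hp, divisorTail_one m hp]
  field_simp
  ring

theorem local_factor_eq {h p : ℕ} (hh : 1 ≤ h) (hp : p.Prime) (k m : ℕ) :
    ∑' e : ℕ, diagSum (gcdKernel h (k + 1) m) (p ^ e)
      = singularFactor (k + 1) (m + 1) p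
        * shiftLocalFactor (k + 1) (m + 1) p (h.factorization p) := by
  have hu := one_sub_inv_prime_pos hp
  have hF := primePowBound_gcdWeight hh (k + 1) m
  have h1 : ∑' e : ℕ, diagSum (gcdKernel h (k + 1) m) (p ^ e)
      = ∑' x : ℕ × ℕ, gcdKernel h (k + 1) m (p ^ x.1) (p ^ x.2) := by
    rw [← tsum_sum_antidiagonal ((primePowBound_gcdKernel hh (k + 1) m).summable hp)]
    exact tsum_congr fun e => diagSum_prime_pow _ hp e
  rw [h1, gcdKernel, tsum_convFst_pow_prime_pow (hF.convSnd_pow m) hp,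
    tsum_convSnd_pow_prime_pow hF hp, pow_succ]
  have h2 := tsum_gcdWeight_prime_pow hh hp (k + 1) m
  rw [shiftLocalFactor, shiftLocalFactor_denom_eq, Nat.add_sub_cancel, ← h2, singularFactor,
    show k + 1 + (m + 1) - 2 = k + m by omega, Nat.add_sub_cancel, Nat.add_sub_cancel, pow_add]
  have hd := shiftLocalFactor_denom_pos k m hp
  set u := 1 - (p : ℝ)⁻¹
  have h3 : u ^ m + u ^ k - u ^ k * u ^ m = u ^ k * u ^ m * ((u ^ k)⁻¹ + (u ^ m)⁻¹ - 1) := by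
    field_simp
  rw [h3]
  set d := (u ^ k)⁻¹ + (u ^ m)⁻¹ - 1
  field_simp

theorem hasProd_shiftLocalFactor (k m h : ℕ) :
    HasProd (fun p : Nat.Primes => shiftLocalFactor (k + 1) (m + 1) p (h.factorization p))
      (shiftFactor (k + 1) (m + 1) h) := by
  have h1 : shiftFactor (k + 1) (m + 1) h = ∏ p ∈ (h.primeFactors.subtype Nat.Prime : Finset Nat.Primes),
      shiftLocalFactor (k + 1) (m + 1) p (h.factorization p) :=
    (Finset.prod_subtype_of_mem (p := Nat.Prime)
      (fun p : ℕ => shiftLocalFactor (k + 1) (m + 1) p (h.factorization p))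
      (fun p hp => Nat.prime_of_mem_primeFactors hp)).symm
  rw [h1]
  refine hasProd_prod_of_ne_finset_one fun p hp => ?_
  have h2 : (p : ℕ) ∉ h.primeFactors := fun h' => hp (Finset.mem_subtype.2 h')
  have h3 : h.factorization p = 0 := by
    rw [← Nat.support_factorization] at h2
    exact Finsupp.notMem_support_iff.1 h2
  rw [h3, shiftLocalFactor_zero k m p.2]

theorem tsum_gcdKernel {h : ℕ} (hh : 1 ≤ h) (k m : ℕ) :
    ∑' x : ℕ × ℕ, gcdKernel h (k + 1) m x.1 x.2
      = singularConst (k + 1) (m + 1) * shiftFactor (k + 1) (m + 1) h := by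
  have hK := biMultiplicative_gcdKernel h (k + 1) m
  have hs := summable_gcdKernel hh (k + 1) m
  have h0 := gcdKernel_zero_left h (k + 1) m
  have h0' := gcdKernel_zero_right h (k + 1) m
  rw [← (hasSum_diagSum h0 h0' hs.of_abs).tsum_eq]
  have hsd : Summable (fun n => ‖diagSum (gcdKernel h (k + 1) m) n‖) := by
    have h1 := (hasSum_diagSum (K := fun a c => |gcdKernel h (k + 1) m a c|)
      (fun n => by simp [h0]) (fun n => by simp [h0']) hs).summable
    exact h1.of_nonneg_of_le (fun _ => norm_nonneg _) fun n => Finset.abs_sum_le_sum_abs _ _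
  have h1 := EulerProduct.eulerProduct_hasProd (diagSum_one hK)
    (fun {m n} hmn => diagSum_mul hK hmn) hsd (diagSum_zero _)
  have h2 : HasProd (fun p : Nat.Primes => singularFactor (k + 1) (m + 1) p
      * shiftLocalFactor (k + 1) (m + 1) p (h.factorization p))
      (singularConst (k + 1) (m + 1) * shiftFactor (k + 1) (m + 1) h) :=
    (multipliable_singularFactor (k + 1) (m + 1) (by omega) (by omega)).hasProd.mul
      (hasProd_shiftLocalFactor k m h)
  have h3 : (fun p : Nat.Primes => ∑' e : ℕ, diagSum (gcdKernel h (k + 1) m) ((p : ℕ) ^ e))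
      = fun p : Nat.Primes => singularFactor (k + 1) (m + 1) p
        * shiftLocalFactor (k + 1) (m + 1) p (h.factorization p) :=
    funext fun p => local_factor_eq hh p.2 k m
  rw [h3] at h1
  exact h1.unique h2

/-- The sum `∑ d_k(n) d_m(q) / φ(q / (h, q))` over the pairs `n ≤ X`, `q ≤ Q` with
`(n, q) = (h, q)`. -/
noncomputable def gcdSum (h k m : ℕ) (X Q : ℝ) : ℝ :=
  ∑ q ∈ Finset.Icc 1 ⌊Q⌋₊, ∑ n ∈ Finset.Icc 1 ⌊X⌋₊, (n : ℝ) * gcdWeight h k m n q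

theorem gcdSum_eq_tsum (h k m : ℕ) (X Q : ℝ) :
    gcdSum h k m X Q = ∑' x : ℕ × ℕ,
      gcdKernel h k m x.1 x.2 * ((x.1 : ℝ) * divisorSum k (X / x.1)) * divisorLogSum m (Q / x.2) := by
  have h1 : gcdSum h k m X Q = ∑ q ∈ Finset.Icc 1 ⌊Q⌋₊, ∑ y ∈ q.divisorsAntidiagonal,
      ∑ n ∈ Finset.Icc 1 ⌊X⌋₊, ∑ x ∈ n.divisorsAntidiagonal,
        (divisorFn k x.1 : ℝ) * (x.2 * (gcdKernel h k m x.2 y.2 * ((divisorFn m y.1 : ℝ) * (y.1 : ℝ)⁻¹))) := by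
    refine Finset.sum_congr rfl fun q hq => ?_
    rw [Finset.sum_comm]
    refine Finset.sum_congr rfl fun n hn => ?_
    have hn0 : n ≠ 0 := by have := (Finset.mem_Icc.1 hn).1; omega
    have hq0 : q ≠ 0 := by have := (Finset.mem_Icc.1 hq).1; omega
    rw [gcdWeight_eq_conv h k m hn0 hq0, Finset.sum_comm]
    simp only [convFst, convSnd, Finset.mul_sum, invFn_pow_apply]
    refine Finset.sum_congr rfl fun x hx => Finset.sum_congr rfl fun y _ => ?_
    have hx1 : (x.1 : ℝ) ≠ 0 := Nat.cast_ne_zero.2 (Nat.left_ne_zero_of_mem_divisorsAntidiagonal hx)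
    obtain ⟨rfl, -⟩ := Nat.mem_divisorsAntidiagonal.1 hx
    push_cast
    field_simp
  rw [h1, sum_Icc_divisorsAntidiagonal' (fun y1 y2 => ∑ n ∈ Finset.Icc 1 ⌊X⌋₊,
    ∑ x ∈ n.divisorsAntidiagonal, (divisorFn k x.1 : ℝ) *
      (x.2 * (gcdKernel h k m x.2 y2 * ((divisorFn m y1 : ℝ) * (y1 : ℝ)⁻¹))))]
  rw [tsum_eq_sum (s := Finset.Icc 1 ⌊X⌋₊ ×ˢ Finset.Icc 1 ⌊Q⌋₊)]
  · rw [Finset.sum_product_right]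
    refine Finset.sum_congr rfl fun c _ => ?_
    have h2 : ∀ d : ℕ, ∑ n ∈ Finset.Icc 1 ⌊X⌋₊, ∑ x ∈ n.divisorsAntidiagonal, (divisorFn k x.1 : ℝ) *
        (x.2 * (gcdKernel h k m x.2 c * ((divisorFn m d : ℝ) * (d : ℝ)⁻¹)))
        = ∑ a ∈ Finset.Icc 1 ⌊X⌋₊, gcdKernel h k m a c * ((a : ℝ) * divisorSum k (X / a))
          * ((divisorFn m d : ℝ) * (d : ℝ)⁻¹) := by
      intro d
      rw [sum_Icc_divisorsAntidiagonal' (fun x1 x2 => (divisorFn k x1 : ℝ) *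
        (x2 * (gcdKernel h k m x2 c * ((divisorFn m d : ℝ) * (d : ℝ)⁻¹))))]
      refine Finset.sum_congr rfl fun a _ => ?_
      rw [← Finset.sum_mul, divisorSum, Nat.floor_div_natCast]
      ring
    simp only [h2]
    rw [Finset.sum_comm]
    refine Finset.sum_congr rfl fun a _ => ?_
    rw [← Finset.mul_sum, divisorLogSum, Nat.floor_div_natCast]
  · rintro ⟨a, c⟩ hac
    rw [Finset.mem_product, Finset.mem_Icc, Finset.mem_Icc] at hac
    rcases Nat.eq_zero_or_pos a with rfl | ha
    · simp
    rcases Nat.eq_zero_or_pos c with rfl | hc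
    · simp [gcdKernel_zero_right]
    by_cases h3 : a ≤ ⌊X⌋₊
    · have h4 : ⌊Q⌋₊ < c := by
        by_contra h5
        exact hac ⟨⟨ha, h3⟩, hc, not_lt.1 h5⟩
      have : divisorLogSum m (Q / c) = 0 := by
        rw [divisorLogSum, Nat.floor_div_natCast, Nat.div_eq_of_lt h4]
        simp
      simp [this]
    · have : divisorSum k (X / a) = 0 := by
        rw [divisorSum, Nat.floor_div_natCast, Nat.div_eq_of_lt (not_le.1 h3)]
        simp
      simp [this]

theorem cast_mul_divisorSum_le (k a : ℕ) {X : ℝ} (hX : 0 ≤ X) :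
    (a : ℝ) * divisorSum (k + 1) (X / a) ≤ X * divisorLogSum k X := by
  rcases Nat.eq_zero_or_pos a with rfl | ha
  · simpa using mul_nonneg hX (divisorLogSum_nonneg k X)
  · have ha' : (1 : ℝ) ≤ a := by exact_mod_cast ha
    have h1 := divisorSum_succ_le k (y := X / a) (by positivity)
    have h2 : divisorLogSum k (X / a) ≤ divisorLogSum k X :=
      divisorLogSum_mono k (div_le_self hX ha')
    calc (a : ℝ) * divisorSum (k + 1) (X / a) ≤ a * (X / a * divisorLogSum k (X / a)) := by gcongr
      _ = X * divisorLogSum k (X / a) := by field_simp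
      _ ≤ _ := by gcongr

theorem divisorLogSum_div_le (m c : ℕ) {Q : ℝ} (hQ : 0 ≤ Q) :
    divisorLogSum m (Q / c) ≤ divisorLogSum m Q := by
  refine divisorLogSum_mono m ?_
  rcases Nat.eq_zero_or_pos c with rfl | hc
  · simpa using hQ
  · exact div_le_self hQ (by exact_mod_cast hc)

theorem gcdSum_le {h : ℕ} (hh : 1 ≤ h) (k m : ℕ) {X Q : ℝ} (hX : 0 ≤ X) (hQ : 0 ≤ Q) :
    gcdSum h (k + 1) m X Q ≤ (∑' x : ℕ × ℕ, |gcdKernel h (k + 1) m x.1 x.2|)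
      * (X * divisorLogSum k X) * divisorLogSum m Q := by
  rw [gcdSum_eq_tsum, ← tsum_mul_right, ← tsum_mul_right]
  have hs := ((summable_gcdKernel hh (k + 1) m).mul_right (X * divisorLogSum k X)).mul_right
    (divisorLogSum m Q)
  have hle : ∀ x : ℕ × ℕ, ‖gcdKernel h (k + 1) m x.1 x.2 * ((x.1 : ℝ) * divisorSum (k + 1) (X / x.1))
      * divisorLogSum m (Q / x.2)‖
      ≤ |gcdKernel h (k + 1) m x.1 x.2| * (X * divisorLogSum k X) * divisorLogSum m Q := by
    intro x
    have h1 := cast_mul_divisorSum_le k x.1 hX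
    have h2 := divisorLogSum_div_le m x.2 hQ
    have h3 := divisorSum_nonneg (k + 1) (X / x.1)
    have h4 := divisorLogSum_nonneg m (Q / x.2)
    have h5 := divisorLogSum_nonneg k X
    rw [norm_mul, norm_mul, Real.norm_eq_abs, Real.norm_of_nonneg h4,
      Real.norm_of_nonneg (mul_nonneg (Nat.cast_nonneg _) h3)]
    gcongr
  exact Summable.tsum_le_tsum (fun x => (Real.le_norm_self _).trans (hle x))
    (Summable.of_norm_bounded hs hle) hs

theorem tendsto_cast_mul_divisorSum (k : ℕ) {a : ℕ} (ha : 1 ≤ a) :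
    Tendsto (fun X : ℝ => (a : ℝ) * divisorSum (k + 1) (X / a) / (X * Real.log X ^ k)) atTop
      (nhds (1 / (k.factorial : ℝ))) := by
  have ha0 : (0 : ℝ) < a := by exact_mod_cast ha
  have hX : Tendsto (fun X : ℝ => X / a) atTop atTop := tendsto_id.atTop_div_const ha0
  have h1 := (tendsto_divisorSum_succ k).comp hX
  have h2 : Tendsto (fun X : ℝ => (1 - Real.log a / Real.log X) ^ k) atTop (nhds 1) := by
    simpa using ((Real.tendsto_log_atTop.const_div_atTop (Real.log a)).const_sub 1).pow k
  have h3 := h1.mul h2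
  rw [mul_one] at h3
  refine h3.congr' ?_
  filter_upwards [eventually_gt_atTop (1 : ℝ), eventually_gt_atTop (a : ℝ)] with X hX1 hXa
  have hL := Real.log_pos hX1
  have hX0 : 0 < X := by linarith
  have h4 : Real.log (X / a) = Real.log X - Real.log a := Real.log_div hX0.ne' ha0.ne'
  have h5 : 0 < Real.log (X / a) := Real.log_pos ((one_lt_div ha0).2 hXa)
  have h6 : 1 - Real.log a / Real.log X = Real.log (X / a) / Real.log X := by
    rw [h4]
    field_simp
  simp only [Function.comp]
  rw [h6, div_pow]
  field_simp

theorem tendsto_divisorLogSum_rpow_div (m : ℕ) {τ : ℝ} (hτ : 0 < τ) {c : ℕ} (hc : 1 ≤ c) :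
    Tendsto (fun X : ℝ => divisorLogSum m (X ^ τ / c) / Real.log X ^ m) atTop
      (nhds (τ ^ m / (m.factorial : ℝ))) := by
  have hc0 : (0 : ℝ) < c := by exact_mod_cast hc
  have hX : Tendsto (fun X : ℝ => X ^ τ / c) atTop atTop :=
    (tendsto_rpow_atTop hτ).atTop_div_const hc0
  have h1 := (tendsto_divisorLogSum m).comp hX
  have h2 : Tendsto (fun X : ℝ => (τ - Real.log c / Real.log X) ^ m) atTop (nhds (τ ^ m)) := by
    simpa using ((Real.tendsto_log_atTop.const_div_atTop (Real.log c)).const_sub τ).pow m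
  have h3 := h1.mul h2
  rw [one_div, inv_mul_eq_div] at h3
  refine h3.congr' ?_
  filter_upwards [eventually_gt_atTop (1 : ℝ), hX.eventually_gt_atTop 1] with X hX1 hXc
  have hL := Real.log_pos hX1
  have hX0 : 0 < X := by linarith
  have h4 : Real.log (X ^ τ / c) = τ * Real.log X - Real.log c := by
    rw [Real.log_div (by positivity) hc0.ne', Real.log_rpow hX0]
  have h5 : 0 < Real.log (X ^ τ / c) := Real.log_pos hXc
  have h6 : τ - Real.log c / Real.log X = Real.log (X ^ τ / c) / Real.log X := by
    rw [h4]
    field_simp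
  simp only [Function.comp]
  rw [h6, div_pow]
  field_simp

theorem tendsto_divisorLogSum_rpow (m : ℕ) {τ : ℝ} (hτ : 0 < τ) :
    Tendsto (fun X : ℝ => divisorLogSum m (X ^ τ) / Real.log X ^ m) atTop
      (nhds (τ ^ m / (m.factorial : ℝ))) := by
  simpa using tendsto_divisorLogSum_rpow_div m hτ le_rfl

theorem tendsto_gcdSum {h : ℕ} (hh : 1 ≤ h) (k m : ℕ) {τ : ℝ} (hτ : 0 < τ) :
    Tendsto (fun X : ℝ => gcdSum h (k + 1) m X (X ^ τ) / (X * Real.log X ^ (k + m))) atTop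
      (nhds (τ ^ m * (singularConst (k + 1) (m + 1) * shiftFactor (k + 1) (m + 1) h)
        / ((k.factorial : ℝ) * (m.factorial : ℝ)))) := by
  have hT := tendsto_divisorLogSum k
  have hT' := tendsto_divisorLogSum_rpow m hτ
  have hs := summable_gcdKernel hh (k + 1) m
  have key := tendsto_tsum_of_dominated_convergence (𝓕 := atTop)
    (f := fun (X : ℝ) (x : ℕ × ℕ) => gcdKernel h (k + 1) m x.1 x.2 *
      ((x.1 : ℝ) * divisorSum (k + 1) (X / x.1) / (X * Real.log X ^ k)) *
      (divisorLogSum m (X ^ τ / x.2) / Real.log X ^ m))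
    (g := fun x : ℕ × ℕ => gcdKernel h (k + 1) m x.1 x.2 * (1 / (k.factorial : ℝ)) *
      (τ ^ m / (m.factorial : ℝ)))
    ((hs.mul_right (1 / (k.factorial : ℝ) + 1)).mul_right (τ ^ m / (m.factorial : ℝ) + 1)) ?_ ?_
  · rw [tsum_mul_right, tsum_mul_right, tsum_gcdKernel hh k m] at key
    refine (key.congr' ?_).trans_eq ?_
    · filter_upwards with X
      rw [gcdSum_eq_tsum, ← tsum_div_const]
      refine tsum_congr fun x => ?_
      rw [pow_add]
      simp only [div_eq_mul_inv, mul_inv]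
      ring
    · congr 1
      field_simp
  · rintro ⟨a, c⟩
    rcases Nat.eq_zero_or_pos a with rfl | ha
    · simp [gcdKernel_zero_left]
    rcases Nat.eq_zero_or_pos c with rfl | hc
    · simp [gcdKernel_zero_right]
    exact ((tendsto_cast_mul_divisorSum k ha).const_mul _).mul
      (tendsto_divisorLogSum_rpow_div m hτ hc)
  · filter_upwards [hT.eventually (gt_mem_nhds (lt_add_one _)),
      hT'.eventually (gt_mem_nhds (lt_add_one _)), eventually_gt_atTop (1 : ℝ)] with X h1 h2 hX x
    have hL := Real.log_pos hX
    have hX0 : 0 < X := by linarith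
    have h3 := divisorSum_nonneg (k + 1) (X / x.1)
    have h4 := divisorLogSum_nonneg m (X ^ τ / x.2)
    have h5 : (x.1 : ℝ) * divisorSum (k + 1) (X / x.1) / (X * Real.log X ^ k)
        ≤ 1 / (k.factorial : ℝ) + 1 := by
      refine le_trans ?_ h1.le
      rw [div_le_div_iff₀ (by positivity) (by positivity)]
      have := cast_mul_divisorSum_le k x.1 hX0.le
      calc _ ≤ X * divisorLogSum k X * Real.log X ^ k := by gcongr
        _ = _ := by ring
    have h6 : divisorLogSum m (X ^ τ / x.2) / Real.log X ^ m ≤ τ ^ m / (m.factorial : ℝ) + 1 := by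
      refine le_trans ?_ h2.le
      have := divisorLogSum_div_le m x.2 (Q := X ^ τ) (by positivity)
      gcongr
    have h7 : 0 ≤ (x.1 : ℝ) * divisorSum (k + 1) (X / x.1) / (X * Real.log X ^ k) := by positivity
    have h8 : 0 ≤ divisorLogSum m (X ^ τ / x.2) / Real.log X ^ m := by positivity
    rw [norm_mul, norm_mul, Real.norm_eq_abs, Real.norm_of_nonneg h7, Real.norm_of_nonneg h8]
    gcongr

theorem sum_Icc_one_add (f : ℕ → ℝ) (a b : ℕ) :
    ∑ n ∈ Finset.Icc 1 (a + b), f n = ∑ n ∈ Finset.Icc 1 a, f n + ∑ n ∈ Finset.Icc 1 b, f (n + a) := by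
  induction b with
  | zero => simp
  | succ b ih =>
    rw [← add_assoc, Finset.sum_Icc_succ_top (by omega), Finset.sum_Icc_succ_top (by omega), ih,
      add_assoc]
    congr 3
    omega

theorem divisorSumAP_le (h k q : ℕ) {x : ℝ} (hx : 0 ≤ x) :
    divisorSumAP k q h (x + h) ≤ divisorSum k h
      + ∑ n ∈ (Finset.Icc 1 ⌊x⌋₊).filter (fun n => q ∣ n), (divisorFn k (n + h) : ℝ) := by
  rw [divisorSumAP, Nat.floor_add_natCast hx, add_comm, Finset.sum_filter, sum_Icc_one_add,
    divisorSum, Nat.floor_natCast, Finset.sum_filter]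
  refine add_le_add (Finset.sum_le_sum fun n _ => ?_) (Finset.sum_le_sum fun n _ => le_of_eq ?_)
  · split_ifs
    · exact le_rfl
    · positivity
  · refine if_congr ?_ rfl rfl
    rw [← Nat.modEq_zero_iff_dvd]
    constructor
    · intro e
      exact Nat.ModEq.add_right_cancel' h (by simpa using e)
    · intro e
      simpa using Nat.ModEq.add_right h e

theorem le_additiveDivisorSum (h k m M : ℕ) (x : ℝ) :
    ∑ q ∈ Finset.Icc 1 M, (divisorFn m q : ℝ) *
        ∑ n ∈ (Finset.Icc 1 ⌊x⌋₊).filter (fun n => q ∣ n), (divisorFn k (n + h) : ℝ)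
      ≤ additiveDivisorSum h k (m + 1) x := by
  simp only [Finset.mul_sum, Finset.sum_filter]
  rw [Finset.sum_comm, additiveDivisorSum]
  refine Finset.sum_le_sum fun n hn => ?_
  have hn0 : n ≠ 0 := by have := (Finset.mem_Icc.1 hn).1; omega
  rw [divisorFn_succ_divisors, Nat.cast_sum, Finset.mul_sum]
  simp only [mul_ite, mul_zero]
  rw [← Finset.sum_filter]
  refine le_trans (le_of_eq (Finset.sum_congr rfl fun q _ => mul_comm _ _))
    (Finset.sum_le_sum_of_subset_of_nonneg ?_ fun _ _ _ => by positivity)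
  intro q hq
  exact Nat.mem_divisors.2 ⟨(Finset.mem_filter.1 hq).2, hn0⟩

theorem divisorSumAPMain_gcd_eq (h k : ℕ) {q : ℕ} (hq : 1 ≤ q) (X : ℝ) :
    divisorSumAPMain k q (h.gcd q) X
      = (∑ n ∈ (Finset.Icc 1 ⌊X⌋₊).filter (fun n => n.gcd q = h.gcd q), (divisorFn k n : ℝ))
        / (Nat.totient (q / h.gcd q) : ℝ) := by
  have hg : 0 < h.gcd q := Nat.gcd_pos_of_pos_right _ hq
  have hgq : h.gcd q * (q / h.gcd q) = q := Nat.mul_div_cancel' (Nat.gcd_dvd_right h q)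
  have hiff : ∀ r : ℕ, (h.gcd q * r).gcd q = h.gcd q ↔ r.Coprime (q / h.gcd q) := by
    intro r
    nth_rewrite 2 [← hgq]
    rw [Nat.gcd_mul_left]
    exact Nat.mul_eq_left hg.ne'
  rw [divisorSumAPMain, Nat.floor_div_natCast]
  congr 1
  refine Finset.sum_bij' (fun r _ => h.gcd q * r) (fun n _ => n / h.gcd q) ?_ ?_ ?_ ?_ ?_
  · intro r hr
    rw [Finset.mem_filter, Finset.mem_Icc] at hr ⊢
    refine ⟨⟨Nat.mul_pos hg hr.1.1, ?_⟩, (hiff r).2 hr.2⟩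
    have := (Nat.le_div_iff_mul_le hg).1 hr.1.2
    rwa [mul_comm]
  · intro n hn
    rw [Finset.mem_filter, Finset.mem_Icc] at hn ⊢
    have hd : h.gcd q ∣ n := hn.2 ▸ Nat.gcd_dvd_left n q
    refine ⟨⟨Nat.div_pos (Nat.le_of_dvd hn.1.1 hd) hg, Nat.div_le_div_right hn.1.2⟩, ?_⟩
    rw [← hiff, Nat.mul_div_cancel' hd]
    exact hn.2
  · intro r _
    exact Nat.mul_div_cancel_left r hg
  · intro n hn
    rw [Finset.mem_filter] at hn
    exact Nat.mul_div_cancel' (hn.2 ▸ Nat.gcd_dvd_left n q)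
  · intro r _
    rfl

theorem sum_cast_mul_gcdWeight (h k m : ℕ) {q : ℕ} (hq : 1 ≤ q) (X : ℝ) :
    ∑ n ∈ Finset.Icc 1 ⌊X⌋₊, (n : ℝ) * gcdWeight h k m n q
      = (divisorFn m q : ℝ) * divisorSumAPMain k q (h.gcd q) X := by
  rw [divisorSumAPMain_gcd_eq h k hq, Finset.sum_filter, ← mul_div_assoc, Finset.mul_sum,
    Finset.sum_div]
  refine Finset.sum_congr rfl fun n hn => ?_
  have hn0 : (n : ℝ) ≠ 0 := by
    have := (Finset.mem_Icc.1 hn).1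
    exact Nat.cast_ne_zero.2 (by omega)
  unfold gcdWeight
  split_ifs
  · field_simp
  · simp

theorem divisorSumAP_eq_main_of_dvd {h k q : ℕ} (hq : 1 ≤ q) (hqh : q ∣ h) (X : ℝ) :
    divisorSumAP k q h X = divisorSumAPMain k q (h.gcd q) X := by
  rw [divisorSumAPMain_gcd_eq h k hq, Nat.gcd_eq_right hqh, Nat.div_self hq, Nat.totient_one,
    Nat.cast_one, div_one, divisorSumAP]
  refine Finset.sum_congr (Finset.filter_congr fun n _ => ?_) fun _ _ => rfl
  rw [Nat.gcd_eq_right_iff_dvd, ← Nat.modEq_zero_iff_dvd]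
  have h0 : h ≡ 0 [MOD q] := (Nat.modEq_zero_iff_dvd).2 hqh
  exact ⟨fun e => e.trans h0, fun e => e.trans h0.symm⟩

theorem divisorSum_le_mul_divisorLogSum (m : ℕ) {Q : ℝ} (hQ : 0 ≤ Q) :
    divisorSum m Q ≤ Q * divisorLogSum m Q := by
  rw [divisorSum, divisorLogSum, Finset.mul_sum]
  refine Finset.sum_le_sum fun q hq => ?_
  obtain ⟨h1, h2⟩ := Finset.mem_Icc.1 hq
  have h3 : (q : ℝ) ≤ Q := (Nat.le_floor_iff hQ).1 h2
  have h4 : (0 : ℝ) < q := by exact_mod_cast h1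
  calc (divisorFn m q : ℝ) = q * (divisorFn m q * (q : ℝ)⁻¹) := by field_simp
    _ ≤ _ := by gcongr

theorem sum_div_totient_le_gcdSum {h : ℕ} (hh : 1 ≤ h) (k m : ℕ) (Q : ℝ) :
    ∑ q ∈ Finset.Icc 1 ⌊Q⌋₊, (divisorFn m q : ℝ) / (Nat.totient (q / h.gcd q) : ℝ)
      ≤ gcdSum h (k + 1) m h Q := by
  refine Finset.sum_le_sum fun q _ => ?_
  have hmem : h ∈ Finset.Icc 1 ⌊(h : ℝ)⌋₊ := by simp [hh]
  refine le_trans ?_ (Finset.single_le_sum (f := fun n : ℕ => (n : ℝ) * gcdWeight h (k + 1) m n q)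
    (fun n _ => mul_nonneg (Nat.cast_nonneg _) (gcdWeight_nonneg _ _ _ _ _)) hmem)
  have h1 : (1 : ℝ) ≤ divisorFn (k + 1) h := by
    exact_mod_cast one_le_divisorFn_succ k (by omega)
  have h2 : (h : ℝ) ≠ 0 := Nat.cast_ne_zero.2 (by omega)
  have e : (h : ℝ) * gcdWeight h (k + 1) m h q
      = divisorFn (k + 1) h * ((divisorFn m q : ℝ) / (Nat.totient (q / h.gcd q) : ℝ)) := by
    simp only [gcdWeight, if_true]
    field_simp
  simp only [e]
  exact le_mul_of_one_le_left (by positivity) h1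

/-- The lower bound for the additive divisor sum obtained from a level of distribution `X ^ τ`, in
which the main term is `gcdSum`. -/
theorem gcdSum_sub_le_additiveDivisorSum {h : ℕ} (hh : 1 ≤ h) (k m : ℕ) {τ : ℝ} {K δ : ℕ → ℝ}
    (hdist : ∀ g : ℕ, 1 ≤ g → ∀ (x : ℝ) (q a : ℕ), 1 ≤ x → 1 ≤ q → (q : ℝ) ≤ x ^ τ →
      Nat.gcd a q = g → ¬ q ∣ a → |divisorSumAP (k + 1) q a x - divisorSumAPMain (k + 1) q g x|
          ≤ K g * (x ^ (1 - δ g) / (Nat.totient (q / g) : ℝ)))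
    {x : ℝ} (hx : 0 ≤ x) :
    gcdSum h (k + 1) m (x + h) ((x + h) ^ τ)
      - (∑ g ∈ h.divisors, |K g| * (x + h) ^ (1 - δ g)) * gcdSum h (k + 1) m h ((x + h) ^ τ)
      - divisorSum (k + 1) h * divisorSum m ((x + h) ^ τ)
      ≤ additiveDivisorSum h (k + 1) (m + 1) x := by
  have hh' : (1 : ℝ) ≤ h := by exact_mod_cast hh
  set X := x + h with hX
  have hX1 : 1 ≤ X := by linarith
  have hX0 : 0 < X := by linarith
  set E := ∑ g ∈ h.divisors, |K g| * X ^ (1 - δ g) with hE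
  have hE0 : 0 ≤ E := Finset.sum_nonneg fun _ _ => by positivity
  have hap : ∀ q ∈ Finset.Icc 1 ⌊X ^ τ⌋₊, divisorSumAPMain (k + 1) q (h.gcd q) X
      - E / (Nat.totient (q / h.gcd q) : ℝ) ≤ divisorSumAP (k + 1) q h X := by
    intro q hq
    obtain ⟨h1, h2⟩ := Finset.mem_Icc.1 hq
    have h3 : (q : ℝ) ≤ X ^ τ := (Nat.le_floor_iff (by positivity)).1 h2
    by_cases hqh : q ∣ h
    · rw [divisorSumAP_eq_main_of_dvd h1 hqh]
      have : 0 ≤ E / (Nat.totient (q / h.gcd q) : ℝ) := by positivity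
      linarith
    · have h4 := hdist (h.gcd q) (Nat.gcd_pos_of_pos_right _ h1) X q h hX1 h1 h3 rfl hqh
      have h5 : |K (h.gcd q)| * X ^ (1 - δ (h.gcd q)) ≤ E :=
        Finset.single_le_sum (f := fun g => |K g| * X ^ (1 - δ g)) (fun _ _ => by positivity)
          (Nat.mem_divisors.2 ⟨Nat.gcd_dvd_left h q, by omega⟩)
      have h6 : K (h.gcd q) * (X ^ (1 - δ (h.gcd q)) / (Nat.totient (q / h.gcd q) : ℝ))
          ≤ E / (Nat.totient (q / h.gcd q) : ℝ) := by
        rw [← mul_div_assoc]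
        gcongr
        exact (mul_le_mul_of_nonneg_right (le_abs_self _) (by positivity)).trans h5
      have h7 := (abs_le.1 (h4.trans h6)).1
      linarith
  have hsum : ∑ q ∈ Finset.Icc 1 ⌊X ^ τ⌋₊, (divisorFn m q : ℝ) *
      (divisorSumAPMain (k + 1) q (h.gcd q) X - E / (Nat.totient (q / h.gcd q) : ℝ)
        - divisorSum (k + 1) h) ≤ additiveDivisorSum h (k + 1) (m + 1) x := by
    refine le_trans (Finset.sum_le_sum fun q hq => ?_)
      (le_additiveDivisorSum h (k + 1) m ⌊X ^ τ⌋₊ x)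
    have h1 := hap q hq
    have h2 := divisorSumAP_le h (k + 1) q hx
    gcongr
    linarith
  refine le_trans ?_ hsum
  have e : ∑ q ∈ Finset.Icc 1 ⌊X ^ τ⌋₊, (divisorFn m q : ℝ) *
      (divisorSumAPMain (k + 1) q (h.gcd q) X - E / (Nat.totient (q / h.gcd q) : ℝ)
        - divisorSum (k + 1) h)
      = gcdSum h (k + 1) m X (X ^ τ)
        - E * ∑ q ∈ Finset.Icc 1 ⌊X ^ τ⌋₊, (divisorFn m q : ℝ) / (Nat.totient (q / h.gcd q) : ℝ)
        - divisorSum (k + 1) h * divisorSum m (X ^ τ) := by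
    rw [gcdSum, divisorSum.eq_1 m, Finset.mul_sum, Finset.mul_sum, ← Finset.sum_sub_distrib,
      ← Finset.sum_sub_distrib]
    refine Finset.sum_congr rfl fun q hq => ?_
    rw [sum_cast_mul_gcdWeight h (k + 1) m (Finset.mem_Icc.1 hq).1]
    ring
  rw [e]
  have := mul_le_mul_of_nonneg_left (sum_div_totient_le_gcdSum hh k m (X ^ τ)) hE0
  linarith

theorem tendsto_rpow_neg_mul_inv_log_pow {s : ℝ} (hs : 0 < s) (k : ℕ) :
    Tendsto (fun X : ℝ => X ^ (-s) * (Real.log X)⁻¹ ^ k) atTop (nhds 0) := by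
  simpa using (tendsto_rpow_neg_atTop hs).mul
    ((Real.tendsto_log_atTop.inv_tendsto_atTop).pow k)

theorem tendsto_rpow_mul_divisorLogSum (k m : ℕ) {s τ : ℝ} (hs : 0 < s) (hτ : 0 < τ) :
    Tendsto (fun X : ℝ => X ^ (1 - s) * divisorLogSum m (X ^ τ) / (X * Real.log X ^ (k + m)))
      atTop (nhds 0) := by
  have h1 := (tendsto_rpow_neg_mul_inv_log_pow hs k).mul (tendsto_divisorLogSum_rpow m hτ)
  rw [zero_mul] at h1
  refine h1.congr' ?_
  filter_upwards [eventually_gt_atTop (1 : ℝ)] with X hX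
  have hL := Real.log_pos hX
  have hX0 : 0 < X := by linarith
  rw [sub_eq_add_neg, Real.rpow_add hX0, Real.rpow_one, pow_add, inv_pow]
  field_simp

theorem tendsto_additiveDivisorSum_minorant {h : ℕ} (hh : 1 ≤ h) (k m : ℕ) {τ : ℝ} (hτ : 0 < τ)
    (hτ1 : τ < 1) (K δ : ℕ → ℝ) (hδ : ∀ g, 1 ≤ g → 0 < δ g) :
    Tendsto (fun X : ℝ => (gcdSum h (k + 1) m X (X ^ τ)
      - (∑ g ∈ h.divisors, |K g| * X ^ (1 - δ g)) * gcdSum h (k + 1) m h (X ^ τ)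
      - divisorSum (k + 1) h * divisorSum m (X ^ τ)) / (X * Real.log X ^ (k + m))) atTop
      (nhds (τ ^ m * (singularConst (k + 1) (m + 1) * shiftFactor (k + 1) (m + 1) h)
        / ((k.factorial : ℝ) * (m.factorial : ℝ)))) := by
  set C : ℝ := (∑' x : ℕ × ℕ, |gcdKernel h (k + 1) m x.1 x.2|) * (h * divisorLogSum k h) with hC
  have hW0 : ∀ Q, 0 ≤ gcdSum h (k + 1) m h Q := fun Q => Finset.sum_nonneg fun _ _ =>
    Finset.sum_nonneg fun _ _ => mul_nonneg (Nat.cast_nonneg _) (gcdWeight_nonneg _ _ _ _ _)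
  have hE1 : Tendsto (fun X : ℝ => (∑ g ∈ h.divisors, |K g| * X ^ (1 - δ g))
      * gcdSum h (k + 1) m h (X ^ τ) / (X * Real.log X ^ (k + m))) atTop (nhds 0) := by
    have h1 : Tendsto (fun X : ℝ => ∑ g ∈ h.divisors, |K g| * C *
        (X ^ (1 - δ g) * divisorLogSum m (X ^ τ) / (X * Real.log X ^ (k + m)))) atTop (nhds 0) := by
      rw [← Finset.sum_const_zero (s := h.divisors)]
      refine tendsto_finsetSum _ fun g hg => ?_
      have := (tendsto_rpow_mul_divisorLogSum k m (hδ g (Nat.pos_of_mem_divisors hg)) hτ).const_mul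
        (|K g| * C)
      rwa [mul_zero] at this
    refine squeeze_zero' ?_ ?_ h1
    · filter_upwards [eventually_gt_atTop (1 : ℝ)] with X hX
      have hL := Real.log_pos hX
      have hX0 : 0 < X := by linarith
      have := hW0 (X ^ τ)
      have : 0 ≤ ∑ g ∈ h.divisors, |K g| * X ^ (1 - δ g) :=
        Finset.sum_nonneg fun _ _ => by positivity
      positivity
    · filter_upwards [eventually_gt_atTop (1 : ℝ)] with X hX
      have hL := Real.log_pos hX
      have hX0 : 0 < X := by linarith
      have h2 := gcdSum_le hh k m (X := h) (Q := X ^ τ) (by positivity) (by positivity)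
      rw [← hC] at h2
      have h3 : 0 ≤ ∑ g ∈ h.divisors, |K g| * X ^ (1 - δ g) :=
        Finset.sum_nonneg fun _ _ => by positivity
      calc _ ≤ (∑ g ∈ h.divisors, |K g| * X ^ (1 - δ g)) * (C * divisorLogSum m (X ^ τ))
            / (X * Real.log X ^ (k + m)) := by gcongr
        _ = _ := by
          rw [Finset.sum_mul, Finset.sum_div]
          refine Finset.sum_congr rfl fun g _ => ?_
          ring
  have hE2 : Tendsto (fun X : ℝ => divisorSum (k + 1) h * divisorSum m (X ^ τ)
      / (X * Real.log X ^ (k + m))) atTop (nhds 0) := by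
    have h1 := (tendsto_rpow_mul_divisorLogSum k m (sub_pos.2 hτ1) hτ).const_mul
      (divisorSum (k + 1) h)
    rw [mul_zero] at h1
    have h0 := divisorSum_nonneg (k + 1) h
    refine squeeze_zero' ?_ ?_ h1
    · filter_upwards [eventually_gt_atTop (1 : ℝ)] with X hX
      have hL := Real.log_pos hX
      have := divisorSum_nonneg m (X ^ τ)
      positivity
    · filter_upwards [eventually_gt_atTop (1 : ℝ)] with X hX
      have hL := Real.log_pos hX
      have hX0 : 0 < X := by linarith
      have h2 := divisorSum_le_mul_divisorLogSum m (Q := X ^ τ) (by positivity)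
      rw [sub_sub_cancel, ← mul_div_assoc]
      gcongr
  have h3 := ((tendsto_gcdSum hh k m hτ).sub hE1).sub hE2
  rw [sub_zero, sub_zero] at h3
  refine h3.congr fun X => ?_
  rw [sub_div, sub_div]

theorem tendsto_shifted_scale (h : ℝ) (j : ℕ) :
    Tendsto (fun x : ℝ => (x + h) * Real.log (x + h) ^ j / (x * Real.log x ^ j)) atTop
      (nhds 1) := by
  have h1 : Tendsto (fun x : ℝ => 1 + h / x) atTop (nhds 1) := by
    simpa using (tendsto_id.const_div_atTop h).const_add (1 : ℝ)
  have h2 : Tendsto (fun x : ℝ => 1 + Real.log (1 + h / x) * (Real.log x)⁻¹) atTop (nhds 1) := by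
    have h3 : Tendsto (fun x : ℝ => Real.log (1 + h / x)) atTop (nhds 0) := by
      have h4 := (Real.continuousAt_log one_ne_zero).tendsto.comp h1
      rwa [Real.log_one] at h4
    simpa using (h3.mul Real.tendsto_log_atTop.inv_tendsto_atTop).const_add (1 : ℝ)
  have h4 := h1.mul (h2.pow j)
  rw [one_pow, mul_one] at h4
  refine h4.congr' ?_
  filter_upwards [eventually_gt_atTop (1 : ℝ), h1.eventually (lt_mem_nhds zero_lt_one)] with x hx hx2
  have hL := Real.log_pos hx
  have hx0 : 0 < x := by linarith
  have h5 : x + h = x * (1 + h / x) := by field_simp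
  have h6 : 1 + Real.log (1 + h / x) * (Real.log x)⁻¹ = Real.log (x + h) / Real.log x := by
    rw [h5, Real.log_mul hx0.ne' hx2.ne']
    field_simp
  rw [h6, div_pow]
  rw [show 1 + h / x = (x + h) / x by field_simp]
  field_simp

theorem le_liminf_of_level {h : ℕ} (hh : 1 ≤ h) (k m : ℕ) {θ : ℝ}
    (hθ : IsExponentForAllGcd (k + 1) θ) {τ : ℝ} (hτ : 0 < τ) (hτθ : τ < θ) :
    ((τ ^ m * (singularConst (k + 1) (m + 1) * shiftFactor (k + 1) (m + 1) h)
        / ((k.factorial : ℝ) * (m.factorial : ℝ)) : ℝ) : EReal)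
      ≤ liminf (fun x : ℝ => ((additiveDivisorSum h (k + 1) (m + 1) x
          / (x * Real.log x ^ (k + m)) : ℝ) : EReal)) atTop := by
  have hθ1 : θ ≤ 1 := (hθ 1 le_rfl).2.1
  have hex : ∀ g : ℕ, ∃ δ K : ℝ, 1 ≤ g → 0 < δ ∧ ∀ (x : ℝ) (q a : ℕ), 1 ≤ x → 1 ≤ q →
      (q : ℝ) ≤ x ^ τ → Nat.gcd a q = g → ¬ q ∣ a →
        |divisorSumAP (k + 1) q a x - divisorSumAPMain (k + 1) q g x|
          ≤ K * (x ^ (1 - δ) / (Nat.totient (q / g) : ℝ)) := by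
    intro g
    by_cases hg : 1 ≤ g
    · obtain ⟨δ, hδ, K, hK⟩ := (hθ g hg).2.2 (θ - τ) (sub_pos.2 hτθ)
      rw [sub_sub_cancel] at hK
      exact ⟨δ, K, fun _ => ⟨hδ, hK⟩⟩
    · exact ⟨0, 0, fun h' => absurd h' hg⟩
  choose δ K hδK using hex
  have h1 := tendsto_additiveDivisorSum_minorant hh k m hτ (hτθ.trans_le hθ1) K δ
    fun g hg => (hδK g hg).1
  have h2 := (h1.comp (tendsto_atTop_add_const_right atTop (h : ℝ) tendsto_id)).mul
    (tendsto_shifted_scale h (k + m))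
  rw [mul_one] at h2
  have h3 := (continuous_coe_real_ereal.tendsto _).comp h2
  rw [← h3.liminf_eq]
  refine liminf_le_liminf ?_
  filter_upwards [eventually_gt_atTop (1 : ℝ)] with x hx
  have hL := Real.log_pos hx
  have hx0 : 0 < x := by linarith
  have hxh : 1 < x + h := by
    have : (0 : ℝ) ≤ h := Nat.cast_nonneg h
    linarith
  have hL' := Real.log_pos hxh
  have hxh0 : 0 < x + h := by linarith
  have h4 := gcdSum_sub_le_additiveDivisorSum hh k m (fun g hg => (hδK g hg).2) hx0.le
  simp only [Function.comp, id]
  refine EReal.coe_le_coe_iff.2 ?_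
  rw [div_mul_div_cancel₀ (by positivity)]
  gcongr

theorem le_liminf_of_exponent {h : ℕ} (hh : 1 ≤ h) (k m : ℕ) {θ : ℝ}
    (hθ : IsExponentForAllGcd (k + 1) θ) :
    ((θ ^ m * (singularConst (k + 1) (m + 1) * shiftFactor (k + 1) (m + 1) h)
        / ((k.factorial : ℝ) * (m.factorial : ℝ)) : ℝ) : EReal)
      ≤ liminf (fun x : ℝ => ((additiveDivisorSum h (k + 1) (m + 1) x
          / (x * Real.log x ^ (k + m)) : ℝ) : EReal)) atTop := by
  have hθ0 : 0 < θ := (hθ 1 le_rfl).1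
  have hc : Continuous (fun τ : ℝ => ((τ ^ m *
      (singularConst (k + 1) (m + 1) * shiftFactor (k + 1) (m + 1) h)
        / ((k.factorial : ℝ) * (m.factorial : ℝ)) : ℝ) : EReal)) :=
    continuous_coe_real_ereal.comp (by fun_prop)
  refine le_of_tendsto ((hc.tendsto θ).mono_left (nhdsWithin_le_nhds (s := Set.Iio θ))) ?_
  filter_upwards [Ioo_mem_nhdsLT hθ0] with τ hτ
  exact le_liminf_of_level hh k m hθ hτ.1 hτ.2

theorem singularFactor_nonneg (k l : ℕ) {p : ℕ} (hp : p.Prime) :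
    0 ≤ singularFactor (k + 1) (l + 1) p := by
  have hu := one_sub_inv_prime_pos hp
  have hu1 : 1 - (p : ℝ)⁻¹ ≤ 1 := by
    have : 0 ≤ (p : ℝ)⁻¹ := by positivity
    linarith
  rw [singularFactor, show k + 1 + (l + 1) - 2 = k + l by omega, Nat.add_sub_cancel,
    Nat.add_sub_cancel, pow_add]
  have h1 : (1 - (p : ℝ)⁻¹) ^ k ≤ 1 := pow_le_one₀ hu.le hu1
  have h2 : 0 ≤ (1 - (p : ℝ)⁻¹) ^ k := by positivity
  have h3 : 0 ≤ (1 - (p : ℝ)⁻¹) ^ l := by positivity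
  nlinarith

theorem singularConst_nonneg (k l : ℕ) : 0 ≤ singularConst (k + 1) (l + 1) := by
  have h := (multipliable_singularFactor (k + 1) (l + 1) (by omega) (by omega)).hasProd
  exact ge_of_tendsto' h fun s => Finset.prod_nonneg fun p _ => singularFactor_nonneg k l p.2

theorem shiftFactor_nonneg (k l h : ℕ) : 0 ≤ shiftFactor (k + 1) (l + 1) h := by
  refine Finset.prod_nonneg fun p hp => ?_
  have hp' := Nat.prime_of_mem_primeFactors hp
  have hu := one_sub_inv_prime_pos hp'
  have ht : ∀ j a, 0 ≤ divisorTail j p a := fun j a => tsum_nonneg fun _ => by positivity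
  rw [shiftLocalFactor, shiftLocalFactor_denom_eq]
  refine div_nonneg (add_nonneg (mul_nonneg hu.le (Finset.sum_nonneg fun a _ => ?_)) ?_)
    (shiftLocalFactor_denom_pos k l hp').le
  · exact mul_nonneg (Nat.cast_nonneg _) (ht _ _)
  · exact mul_nonneg (Nat.cast_nonneg _) (ht _ _)

theorem corollaryI (h : ℕ) (hh : 1 ≤ h) :
    (∀ k l : ℕ, 1 ≤ k → 1 ≤ l → ∀ θ : ℝ, IsExponentForAllGcd k θ →
      ((θ ^ (l - 1) * (singularConst k l * shiftFactor k l h)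
          / (((k - 1).factorial : ℝ) * ((l - 1).factorial : ℝ)) : ℝ) : EReal)
        ≤ liminf (fun x : ℝ =>
            ((additiveDivisorSum h k l x / (x * Real.log x ^ (k + l - 2)) : ℝ) : EReal)) atTop) ∧
    (IsExponentForAllGcd 3 (21 / 41) →
      ((0.262 * (singularConst 3 3 * shiftFactor 3 3 h) / 4 : ℝ) : EReal)
        ≤ liminf (fun x : ℝ =>
            ((additiveDivisorSum h 3 3 x / (x * Real.log x ^ 4) : ℝ) : EReal)) atTop) := by
  refine ⟨fun k l hk hl θ hθ => ?_, fun hθ => ?_⟩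
  · obtain ⟨k, rfl⟩ : ∃ j, k = j + 1 := ⟨k - 1, by omega⟩
    obtain ⟨m, rfl⟩ : ∃ j, l = j + 1 := ⟨l - 1, by omega⟩
    rw [show k + 1 + (m + 1) - 2 = k + m by omega, Nat.add_sub_cancel, Nat.add_sub_cancel]
    exact le_liminf_of_exponent hh k m hθ
  · refine le_trans (EReal.coe_le_coe_iff.2 ?_) (le_liminf_of_exponent hh 2 2 hθ)
    have h0 : 0 ≤ singularConst 3 3 * shiftFactor 3 3 h :=
      mul_nonneg (singularConst_nonneg 2 2) (shiftFactor_nonneg 2 2 h)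
    norm_num [Nat.factorial]
    linarith
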